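/- Let $n\ge 1$ and let $(M,\omega)$ be an $n$-plectic manifold: $M$ is a smooth manifold and $\omega\in\Omega^{n+1}(M)$ is closed with $T_mM\to\bigwedge^nT_m^*M$, $v\mapsto i_v\omega_m$, injective for every $m\in M$. For multivector fields put $i_{X_1\wedge\dots\wedge X_r}\alpha=i_{X_r}\cdots i_{X_1}\alpha$, extended linearly, and $L_X\alpha=d(i_X\alpha)-(-1)^r\,i_X d\alpha$ for $X$ of tensor degree $r$, extended linearly in $X$. A multivector field $X$ is a semi-Hamiltonian multivector field associated to a form $f$ if $i_X\omega=-df$. A form $f\in\Omega(M)$ is Hamiltonian if there are multivector fields $X$ and $Y$ with $i_X\omega=-df$ and $i_Y\omega=-f$; $H(M)$ denotes the set of Hamiltonian forms. A Hamiltonian form that is homogeneous of tensor degree $r$ has symmetric degree $\deg f=n-r$. Write $e(f)=(-1)^{\deg f}$, $e(f,g)=(-1)^{\deg f\,\deg g}$, and let $e(s;f_1,f_2,f_3)$ be the Koszul sign of a permutation $s$, given by $f_1\otimes f_2\otimes f_3=e(s;f_1,f_2,f_3)\,f_{s_1}\otimes f_{s_2}\otimes f_{s_3}$. For homogeneous $f_1,f_2\in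 H(M)$ with associated semi-Hamiltonian multivector fields $X_1,X_2$ let $$D_2(f_1,f_2)=e(f_1)\,L_{X_1}f_2+e(f_1,f_2)\,e(f_2)\,L_{X_2}f_1,$$ extended to $H(M)$ by linearity. Let $Sh(2,1)$ be the set of permutations $s$ of $\{1,2,3\}$ with $s_1<s_2$. Then $D_2(f_1,f_2)$ does not depend on the choice of $X_1,X_2$ and is again a Hamiltonian form. For any three homogeneous $f_1,f_2,f_3\in H(M)$, and any semi-Hamiltonian multivector fields $X_{D_2}(f_i,f_j)$ associated to $D_2(f_i,f_j)$, $$\sum_{s\in Sh(2,1)}e(s;f_1,f_2,f_3)\,D_2\bigl(D_2(f_{s_1},f_{s_2}),f_{s_3}\bigr) =-\tfrac12\sum_{s\in Sh(2,1)}e(s;f_1,f_2,f_3)\,e(f_{s_1})\,e(f_{s_2})\,L_{X_{D_2}(f_{s_1},f_{s_2})}f_{s_3}.$$ The graded Jacobi identity fails in general: there are an $n$-plectic manifold, which may be taken to be some $\mathbb R^d$ with an $n$-plectic form, and homogeneous Hamiltonian forms $f_1,f_2,f_3$ on it for which the left-hand side is not zero. -/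

import Mathlib

open scoped Manifold

noncomputable section

namespace NPlectic

universe u v

/-! ### Signs and shuffles -/

/-- The set `Sh(p,q)` of shuffle permutations `s` of `p + q` letters:
`s 0 < ⋯ < s (p-1)` and `s p < ⋯ < s (p+q-1)`. -/
def shuffles (p q : ℕ) : Finset (Equiv.Perm (Fin (p + q))) :=
  Finset.univ.filter fun s =>
    StrictMono (fun i : Fin p => s (Fin.castAdd q i)) ∧
      StrictMono (fun j : Fin q => s (Fin.natAdd p j))

/-- The sign `e(v) = (-1)^deg v`. -/
def sgn (a : ℤ) : ℝ := (-1) ^ a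

/-- The sign `e(v, w) = (-1)^(deg v * deg w)`. -/
def sgn₂ (a b : ℤ) : ℝ := (-1) ^ (a * b)

/-- The Koszul sign `e(s; v_1, …, v_k)`, defined by
`v_1 ⊗ ⋯ ⊗ v_k = e(s; v_1, …, v_k) v_{s_1} ⊗ ⋯ ⊗ v_{s_k}`, as a function of the degrees:
each pair of letters whose order is reversed contributes the sign `e(v, w)`. -/
def koszulSign {k : ℕ} (s : Equiv.Perm (Fin k)) (deg : Fin k → ℤ) : ℝ :=
  ∏ p : Fin k × Fin k,
    if p.1 < p.2 ∧ s p.2 < s p.1 then sgn₂ (deg (s p.1)) (deg (s p.2)) else 1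

/-! ### Contraction of an alternating form along a multivector -/

theorem append_update_left {V : Type u} {r k : ℕ} (w : Fin r → V) (z : Fin k → V) (i : Fin r) (x : V) :
    Fin.append (Function.update w i x) z
      = Function.update (Fin.append w z) (Fin.castAdd k i) x := by
  ext j
  refine Fin.addCases (fun j => ?_) (fun j => ?_) j
  · by_cases h : j = i
    · subst h; simp
    · have : Fin.castAdd k j ≠ Fin.castAdd k i := fun h' => h (Fin.castAdd_injective r k h')
      simp [h, this]
  · have : Fin.natAdd r j ≠ Fin.castAdd k i := by
      intro h'; have := congrArg Fin.val h'; simp at this; omega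
    simp [this]

theorem append_update_right {V : Type u} {r k : ℕ} (w : Fin r → V) (z : Fin k → V) (i : Fin k) (x : V) :
    Fin.append w (Function.update z i x)
      = Function.update (Fin.append w z) (Fin.natAdd r i) x := by
  ext j
  refine Fin.addCases (fun j => ?_) (fun j => ?_) j
  · have : Fin.castAdd k j ≠ Fin.natAdd r i := by
      intro h'; have := congrArg Fin.val h'; simp at this; omega
    simp [this]
  · by_cases h : j = i
    · subst h; simp
    · have : Fin.natAdd r j ≠ Fin.natAdd r i := fun h' => h (Fin.natAdd_injective k r h')
      simp [h, this]

section Contraction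

variable {V : Type u} [AddCommGroup V] [Module ℝ V] [TopologicalSpace V]

/-- Repeated contraction `i_{w_r} ⋯ i_{w_1} α`, that is `z ↦ α (w_1, …, w_r, z_1, …, z_k)`. -/
def contractTuple {r k : ℕ} (α : V [⋀^Fin (r + k)]→L[ℝ] ℝ) (w : Fin r → V) :
    V [⋀^Fin k]→L[ℝ] ℝ where
  toFun z := α (Fin.append w z)
  map_update_add' := by
    intro inst z i x y
    obtain rfl := Subsingleton.elim inst (instDecidableEqFin k)
    simp only [append_update_right]
    exact α.map_update_add _ _ _ _
  map_update_smul' := by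
    intro inst z i c x
    obtain rfl := Subsingleton.elim inst (instDecidableEqFin k)
    simp only [append_update_right]
    exact α.map_update_smul _ _ _ _
  map_eq_zero_of_eq' z i j hz hij :=
    α.map_eq_zero_of_eq (Fin.append w z) (by simpa using hz)
      (fun h => hij (Fin.natAdd_injective k r h))
  cont := by
    refine α.cont.comp (continuous_pi fun j => ?_)
    refine Fin.addCases (fun j => ?_) (fun j => ?_) j
    · simpa using continuous_const
    · simpa using continuous_apply j

variable [IsTopologicalAddGroup V] [ContinuousSMul ℝ V]

/-- Repeated contraction of `α`, as an alternating function of the contracting vectors. -/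
def contractAlternating {r k : ℕ} (α : V [⋀^Fin (r + k)]→L[ℝ] ℝ) :
    V [⋀^Fin r]→ₗ[ℝ] (V [⋀^Fin k]→L[ℝ] ℝ) where
  toFun w := contractTuple α w
  map_update_add' := by
    intro inst w i x y
    obtain rfl := Subsingleton.elim inst (instDecidableEqFin r)
    ext z
    change α _ = α _ + α _
    simp only [append_update_left]
    exact α.map_update_add _ _ _ _
  map_update_smul' := by
    intro inst w i c x
    obtain rfl := Subsingleton.elim inst (instDecidableEqFin r)
    ext z
    change α _ = c • α _
    simp only [append_update_left]
    exact α.map_update_smul _ _ _ _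
  map_eq_zero_of_eq' w i j hw hij := by
    ext z
    exact α.map_eq_zero_of_eq (Fin.append w z) (by simpa using hw)
      (fun h => hij (Fin.castAdd_injective r k h))

/-- The contraction `i_x α` of an `(r+k)`-form along an `r`-vector: the linear extension of
`i_{w_1 ∧ ⋯ ∧ w_r} α = i_{w_r} ⋯ i_{w_1} α`. -/
def contract {r k : ℕ} (x : ⋀[ℝ]^r V) (α : V [⋀^Fin (r + k)]→L[ℝ] ℝ) : V [⋀^Fin k]→L[ℝ] ℝ :=
  exteriorPower.alternatingMapLinearEquiv (contractAlternating α) x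

end Contraction

/-! ### Differential forms and multivector fields on a manifold -/

section Manifold

variable (E : Type u) [NormedAddCommGroup E] [NormedSpace ℝ E]
  (M : Type v) [TopologicalSpace M] [ChartedSpace E M]

/-- Not necessarily smooth sections of `⋀^r T^*M`. -/
abbrev FormSection (r : ℕ) : Type (max u v) :=
  (m : M) → TangentSpace 𝓘(ℝ, E) m [⋀^Fin r]→L[ℝ] ℝ

/-- Not necessarily smooth sections of `⋀^r TM`. -/
abbrev MultivectorSection (r : ℕ) : Type (max u v) :=
  (m : M) → ⋀[ℝ]^r (TangentSpace 𝓘(ℝ, E) m)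

/-- Families of sections of `⋀^r T^*M`, one for each `r`. As these vanish for `r > dim M`, the
product over all `r` is the direct sum, and the smooth elements are the forms in `Ω(M)`. -/
abbrev Form : Type (max u v) := (r : ℕ) → FormSection E M r

/-- Families of sections of `⋀^r TM`, one for each `r`; the smooth elements are the
multivector fields in `𝔛(M)`. -/
abbrev Multivector : Type (max u v) := (r : ℕ) → MultivectorSection E M r

variable {E M}

/-- The expression of an `r`-form in the preferred chart at `x`. -/
def FormSection.inChart {r : ℕ} (α : FormSection E M r) (x : M) : E → E [⋀^Fin r]→L[ℝ] ℝ :=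
  fun y => (α ((extChartAt 𝓘(ℝ, E) x).symm y)).compContinuousLinearMap
    (mfderiv 𝓘(ℝ, E) 𝓘(ℝ, E) (extChartAt 𝓘(ℝ, E) x).symm y)

/-- The expression of an `r`-vector field in the preferred chart at `x`. -/
def MultivectorSection.inChart {r : ℕ} (X : MultivectorSection E M r) (x : M) : E → ⋀[ℝ]^r E :=
  fun y => exteriorPower.map r
    (mfderiv 𝓘(ℝ, E) 𝓘(ℝ, E) (extChartAt 𝓘(ℝ, E) x)
      ((extChartAt 𝓘(ℝ, E) x).symm y)).toLinearMap
    (X ((extChartAt 𝓘(ℝ, E) x).symm y))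

/-- Smoothness of an `r`-form. -/
def FormSection.IsSmooth {r : ℕ} (α : FormSection E M r) : Prop :=
  ∀ x : M, ContDiffOn ℝ (⊤ : ℕ∞) (α.inChart x) (extChartAt 𝓘(ℝ, E) x).target

/-- Smoothness of an `r`-vector field: in charts, all its coordinates, that is its pairings with
constant `r`-forms on `E`, are smooth. -/
def MultivectorSection.IsSmooth {r : ℕ} (X : MultivectorSection E M r) : Prop :=
  ∀ (x : M) (l : E [⋀^Fin r]→ₗ[ℝ] ℝ),
    ContDiffOn ℝ (⊤ : ℕ∞) (fun y => exteriorPower.alternatingMapLinearEquiv l (X.inChart x y))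
      (extChartAt 𝓘(ℝ, E) x).target

/-- The exterior derivative of an `r`-form, computed at `m` in the preferred chart at `m`. -/
def FormSection.d {r : ℕ} (α : FormSection E M r) : FormSection E M (r + 1) :=
  fun m => (extDeriv (α.inChart m) (extChartAt 𝓘(ℝ, E) m m)).compContinuousLinearMap
    (mfderiv 𝓘(ℝ, E) 𝓘(ℝ, E) (extChartAt 𝓘(ℝ, E) m) m)

/-- Smoothness of an element of `Ω(M)`. -/
def Form.IsSmooth (α : Form E M) : Prop := ∀ r, FormSection.IsSmooth (α r)

/-- Smoothness of an element of `𝔛(M)`. -/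
def Multivector.IsSmooth (X : Multivector E M) : Prop := ∀ r, MultivectorSection.IsSmooth (X r)

/-- `α` is homogeneous of tensor degree `r`. -/
def Form.IsHomogeneous (r : ℕ) (α : Form E M) : Prop := ∀ k, k ≠ r → α k = 0

/-- The homogeneous component of `α` of tensor degree `r`. -/
def Form.component (α : Form E M) (r : ℕ) : Form E M := Pi.single r (α r)

/-- The exterior derivative on `Ω(M)`. -/
def Form.d (α : Form E M) : Form E M
  | 0 => 0
  | r + 1 => FormSection.d (α r)

/-- The contraction `i_X α`. The sum runs over all degrees `r` in which `⋀^r TM` may be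
nonzero. -/
def Form.contract (X : Multivector E M) (α : Form E M) : Form E M :=
  fun k m => ∑ r ∈ Finset.range (Module.finrank ℝ E + 1), NPlectic.contract (X r m) (α (r + k) m)

/-- The Lie derivative `L_X α`, which is `d (i_X α) - (-1)^r i_X (d α)` if `X` is homogeneous of
tensor degree `r`, extended to all `X` by linearity. -/
def Form.lieDeriv (X : Multivector E M) (α : Form E M) : Form E M :=
  Form.d (Form.contract X α)
    - Form.contract (fun r => (-1 : ℝ) ^ r • X r : Multivector E M) (Form.d α)

/-! ### `n`-plectic manifolds and Hamiltonian forms -/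

/-- `ω` is an `n`-plectic form: smooth, closed, and `v ↦ i_v ω_m` is injective on each `T_m M`. -/
structure IsNPlectic {n : ℕ} (ω : FormSection E M (n + 1)) : Prop where
  one_le : 1 ≤ n
  smooth : FormSection.IsSmooth ω
  closed : FormSection.d ω = 0
  nondegenerate : ∀ m : M, Function.Injective
    (fun v : TangentSpace 𝓘(ℝ, E) m => (ω m).toAlternatingMap.curryLeft v)

/-- A homogeneous form of tensor degree `r`, as an element of `Ω(M)`. -/
def FormSection.toForm {r : ℕ} (α : FormSection E M r) : Form E M := Pi.single r α

variable {n : ℕ} (ω : FormSection E M (n + 1))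

/-- First fundamental equation `i_X ω = -df`: `X` is a semi-Hamiltonian multivector field
associated to `f`. -/
def IsSemiHamiltonianField (f : Form E M) (X : Multivector E M) : Prop :=
  Multivector.IsSmooth X ∧ Form.contract X ω.toForm = -Form.d f

/-- Second fundamental equation `i_Y ω = -f`: `Y` is a Hamiltonian multivector field
associated to `f`. -/
def IsHamiltonianField (f : Form E M) (Y : Multivector E M) : Prop :=
  Multivector.IsSmooth Y ∧ Form.contract Y ω.toForm = -f

/-- `f` is a Hamiltonian form. -/
def IsHamiltonian (f : Form E M) : Prop :=
  Form.IsSmooth f ∧ (∃ X, IsSemiHamiltonianField ω f X) ∧ ∃ Y, IsHamiltonianField ω f Y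

open Classical in
/-- A choice of a semi-Hamiltonian multivector field associated to `f` (zero if there is none,
which does not happen for a Hamiltonian form). -/
def semiHamiltonianField (f : Form E M) : Multivector E M :=
  if h : ∃ X, IsSemiHamiltonianField ω f X then h.choose else 0

/-- The symmetric degree `n - r` of a form of tensor degree `r`. -/
def symDeg (n r : ℕ) : ℤ := (n : ℤ) - (r : ℤ)

/-- The strong homotopy Lie 2-bracket, which is
`D₂(f, g) = e(f) L_{X_f} g + e(f,g) e(g) L_{X_g} f` for homogeneous `f`, `g`, extended by linearity;
the signs refer to the symmetric degree. -/
def D₂ (f g : Form E M) : Form E M :=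
  ∑ a ∈ Finset.range (Module.finrank ℝ E + 1), ∑ b ∈ Finset.range (Module.finrank ℝ E + 1),
    (sgn (symDeg n a) •
        Form.lieDeriv (semiHamiltonianField ω (f.component a)) (g.component b)
      + (sgn₂ (symDeg n a) (symDeg n b) * sgn (symDeg n b)) •
        Form.lieDeriv (semiHamiltonianField ω (g.component b)) (f.component a))

/-- The graded Jacobi expression
`∑_{s ∈ Sh(2,1)} e(s; f₁, f₂, f₃) D₂(D₂(f_{s₁}, f_{s₂}), f_{s₃})`
of homogeneous forms `f i` of tensor degrees `a i`. -/
def jacobiator (a : Fin 3 → ℕ) (f : Fin 3 → Form E M) : Form E M :=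
  ∑ s ∈ shuffles 2 1, koszulSign s (fun i => symDeg n (a i)) •
    D₂ ω (D₂ ω (f (s 0)) (f (s 1))) (f (s 2))

end Manifold

end NPlectic

end

/-!
A form `α` acts on `⋀ TM` as a linear functional, and `i_X α` is `α` composed with the wedge
product by `X`. The Schouten bracket is characterised by `i_{[X, Y]} = [[d, i_X], i_Y]` (graded
commutators), from which `L_{[X, Y]}` is, up to sign, `[L_X, L_Y]`.

A semi-Hamiltonian field `X` of a form `f` satisfies `L_X ω = d i_X ω = 0`. Applied to `ω`, the
characterisation of the bracket gives `i_{[X, Y]} ω = ± L_X i_Y ω = ± d i_X i_Y ω`. A field `T` with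
`i_T ω = 0` satisfies `L_T f = 0` for every Hamiltonian `f`, as `f` and `df` are contractions of
`ω`; hence `L_X f` depends only on `i_X ω`, and `D₂` is well defined. Hamiltonian fields of
`D₂ f g` are obtained from brackets of those of `f` and `g`, and `-2 [X, Y]` is up to sign
a semi-Hamiltonian field of `D₂ f g`. Expanding `L_{[X, Y]}`, the summands `L_{D₂ f g} h` and
`L_h D₂ f g` of `D₂ (D₂ f g) h` yield the same six terms `L_i L_j f_k`, and the latter cancel half
of the former.

The identity fails on the plane with its area form: for `x² dy`, `y²` and `1` only the term with
`D₂ (x² dy) y²` contributes, since `d 1 = 0`, and the jacobiator is `-4 dy`.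
-/

noncomputable section

namespace NPlectic

universe u v

/-! ### Signs -/

theorem sgn_mul_self (a : ℤ) : sgn a * sgn a = 1 := by
  rw [sgn, ← zpow_add₀ (by norm_num), (Even.add_self a).neg_one_zpow]

theorem sgn_add (a b : ℤ) : sgn (a + b) = sgn a * sgn b :=
  zpow_add₀ (by norm_num) a b

theorem sgn_neg (a : ℤ) : sgn (-a) = sgn a := by
  rw [sgn, sgn, zpow_neg, ← inv_zpow, inv_neg, inv_one]

theorem sgn_sub (a b : ℤ) : sgn (a - b) = sgn a * sgn b := by
  rw [sub_eq_add_neg, sgn_add, sgn_neg]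

theorem sgn_one : sgn 1 = -1 := zpow_one _

theorem sgn_natCast (k : ℕ) : sgn k = (-1) ^ k := zpow_natCast _ _

/-! ### The exterior algebra -/

section CliffordAlgebra

open CliffordAlgebra (involute contractLeft)

variable {R V : Type*} [CommRing R] [AddCommGroup V] [Module R V] {Q : QuadraticForm R V}

theorem contractLeft_mul (e : Module.Dual R V) (x z : CliffordAlgebra Q) :
    contractLeft e (x * z) = contractLeft e x * z + involute x * contractLeft e z := by
  induction x using CliffordAlgebra.left_induction with
  | algebraMap r =>
    rw [CliffordAlgebra.contractLeft_algebraMap_mul, CliffordAlgebra.contractLeft_algebraMap,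
      AlgHom.commutes, zero_mul, zero_add]
  | add a b ha hb =>
    simp only [add_mul, map_add, ha, hb]
    abel
  | ι_mul x m hx =>
    simp only [mul_assoc, CliffordAlgebra.contractLeft_ι_mul, hx, map_mul,
      CliffordAlgebra.involute_ι, sub_mul, smul_mul_assoc, mul_add, neg_mul]
    abel

theorem involute_contractLeft (e : Module.Dual R V) (x : CliffordAlgebra Q) :
    involute (contractLeft e x) = -contractLeft e (involute x) := by
  induction x using CliffordAlgebra.left_induction with
  | algebraMap r => simp
  | add a b ha hb => simp only [map_add, ha, hb, neg_add]
  | ι_mul x m hx =>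
    simp only [CliffordAlgebra.contractLeft_ι_mul, map_sub, map_smul, map_mul,
      CliffordAlgebra.involute_ι, hx, neg_mul, mul_neg, map_neg]
    abel

end CliffordAlgebra

section ExteriorAlgebra

open CliffordAlgebra (involute contractLeft)
open ExteriorAlgebra (ι ιMulti)

variable {R V : Type*} [CommRing R] [AddCommGroup V] [Module R V]

theorem ι_mul_eq_involute_mul_ι (v : V) (y : ExteriorAlgebra R V) :
    ι R v * y = involute y * ι R v := by
  induction y using CliffordAlgebra.left_induction with
  | algebraMap r =>
    rw [AlgHom.commutes]
    exact (Algebra.commutes r _).symm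
  | add x y hx hy => rw [mul_add, hx, hy, map_add, add_mul]
  | ι_mul x m hx =>
    have swap : ι R v * ι R m = -(ι R m * ι R v) :=
      eq_neg_of_add_eq_zero_left (ExteriorAlgebra.ι_add_mul_swap v m)
    calc ι R v * (ι R m * x) = -(ι R m * (ι R v * x)) := by
          rw [← mul_assoc, swap, neg_mul, mul_assoc]
      _ = involute (ι R m * x) * ι R v := by
          rw [hx, map_mul, ι, CliffordAlgebra.involute_ι, neg_mul, neg_mul, mul_assoc]

theorem mul_comm_of_even {y : ExteriorAlgebra R V} (hy : involute y = y)
    (x : ExteriorAlgebra R V) : y * x = x * y := by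
  induction x using CliffordAlgebra.left_induction with
  | algebraMap r => exact (Algebra.commutes r _).symm
  | add a b ha hb => rw [mul_add, ha, hb, add_mul]
  | ι_mul x m hx =>
    have hm : ι R m * y = y * ι R m := by rw [ι_mul_eq_involute_mul_ι, hy]
    calc y * (ι R m * x) = ι R m * (y * x) := by rw [← mul_assoc, ← hm, mul_assoc]
      _ = ι R m * x * y := by rw [hx, mul_assoc]

theorem mul_eq_involute_mul_of_odd {y : ExteriorAlgebra R V} (hy : involute y = -y)
    (x : ExteriorAlgebra R V) : y * x = involute x * y := by
  induction x using CliffordAlgebra.left_induction with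
  | algebraMap r =>
    rw [AlgHom.commutes]
    exact (Algebra.commutes r _).symm
  | add a b ha hb => rw [mul_add, ha, hb, map_add, add_mul]
  | ι_mul x m hx =>
    have hm : y * ι R m = -(ι R m * y) := by rw [ι_mul_eq_involute_mul_ι, hy, neg_mul, neg_neg]
    calc y * (ι R m * x) = -(ι R m * (y * x)) := by rw [← mul_assoc, hm, neg_mul, mul_assoc]
      _ = involute (ι R m * x) * y := by
          rw [hx, map_mul, ι, CliffordAlgebra.involute_ι, neg_mul, neg_mul, mul_assoc]

theorem two_smul_mul (x y : ExteriorAlgebra R V) :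
    (2 : R) • (x * y) = y * (x + involute x) + involute y * (x - involute x) := by
  rw [← mul_comm_of_even (y := x + involute x)
      (by rw [map_add, CliffordAlgebra.involute_involute, add_comm]),
    ← mul_eq_involute_mul_of_odd (y := x - involute x)
      (by rw [map_sub, CliffordAlgebra.involute_involute, neg_sub]), ← add_mul, two_smul, ← add_mul]
  congr 1
  abel

theorem involute_ιMulti {k : ℕ} (v : Fin k → V) :
    involute (ιMulti R k v) = (-1 : R) ^ k • ιMulti R k v := by
  have := CliffordAlgebra.involute_prod_map_ι (Q := (0 : QuadraticForm R V)) (List.ofFn v)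
  rwa [List.map_ofFn, List.length_ofFn] at this

theorem involute_of_mem {k : ℕ} {x : ExteriorAlgebra R V} (hx : x ∈ ⋀[R]^k V) :
    involute x = (-1 : R) ^ k • x := by
  rw [← ExteriorAlgebra.ιMulti_span_fixedDegree] at hx
  induction hx using Submodule.span_induction with
  | mem x h => obtain ⟨v, rfl⟩ := h; exact involute_ιMulti v
  | zero => simp
  | add x y _ _ hx hy => rw [map_add, hx, hy, smul_add]
  | smul c x _ hx => rw [map_smul, hx, smul_comm]

theorem contractLeft_ιMulti (e : Module.Dual R V) {k : ℕ} (v : Fin (k + 1) → V) :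
    contractLeft e (ιMulti R (k + 1) v) =
      ∑ i : Fin (k + 1), ((-1 : R) ^ (i : ℕ) * e (v i)) • ιMulti R k (i.removeNth v) := by
  induction k with
  | zero =>
    rw [ExteriorAlgebra.ιMulti_succ_apply]
    refine (CliffordAlgebra.contractLeft_ι_mul _ _ _).trans ?_
    simp
  | succ k ih =>
    have tail (i : Fin (k + 1)) :
        Matrix.vecTail (i.succ.removeNth v) = i.removeNth (Matrix.vecTail v) := by
      ext j
      simp [Matrix.vecTail, Fin.removeNth]
    have head (i : Fin (k + 1)) : i.succ.removeNth v 0 = v 0 := by simp [Fin.removeNth]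
    rw [ExteriorAlgebra.ιMulti_succ_apply]
    refine (CliffordAlgebra.contractLeft_ι_mul _ _ _).trans ?_
    rw [ih, Fin.sum_univ_succ (n := k + 1), sub_eq_add_neg, Fin.val_zero, pow_zero, one_mul,
      Finset.mul_sum, ← Finset.sum_neg_distrib]
    refine congrArg (_ + ·) (Finset.sum_congr rfl fun i _ => ?_)
    rw [ExteriorAlgebra.ιMulti_succ_apply (i.succ.removeNth v), tail, head, mul_smul_comm,
      ← neg_smul, Fin.val_succ, pow_succ, mul_neg_one, neg_mul]
    rfl

theorem linearMap_ext_ιMulti {N : Type*} [AddCommGroup N] [Module R N]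
    {f g : ExteriorAlgebra R V →ₗ[R] N}
    (h : ∀ (k : ℕ) (v : Fin k → V), f (ιMulti R k v) = g (ιMulti R k v)) : f = g :=
  ExteriorAlgebra.lhom_ext fun k => AlternatingMap.ext (h k)

theorem coe_exteriorPower_map {W : Type*} [AddCommGroup W] [Module R W] {k : ℕ} (f : V →ₗ[R] W)
    (x : ⋀[R]^k V) :
    (exteriorPower.map k f x : ExteriorAlgebra R W) = ExteriorAlgebra.map f x := by
  have : (⋀[R]^k W).subtype ∘ₗ exteriorPower.map k f
      = (ExteriorAlgebra.map f).toLinearMap ∘ₗ (⋀[R]^k V).subtype := by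
    apply exteriorPower.linearMap_ext
    ext v
    simp [ExteriorAlgebra.map_apply_ιMulti]
  exact LinearMap.congr_fun this x

theorem involute_map {W : Type*} [AddCommGroup W] [Module R W] (f : V →ₗ[R] W)
    (x : ExteriorAlgebra R V) :
    involute (ExteriorAlgebra.map f x) = ExteriorAlgebra.map f (involute x) := by
  have : involute.toLinearMap ∘ₗ (ExteriorAlgebra.map f).toLinearMap
      = (ExteriorAlgebra.map f).toLinearMap ∘ₗ involute.toLinearMap := by
    refine linearMap_ext_ιMulti fun k v => ?_
    simp only [LinearMap.comp_apply, AlgHom.toLinearMap_apply, ExteriorAlgebra.map_apply_ιMulti,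
      involute_ιMulti, map_smul]
  exact LinearMap.congr_fun this x

instance finite_exteriorAlgebra [Module.Free R V] [Module.Finite R V] :
    Module.Finite R (ExteriorAlgebra R V) := by
  cases subsingleton_or_nontrivial R
  · have := Module.subsingleton R (ExteriorAlgebra R V)
    infer_instance
  · exact .of_basis (Module.finBasis R V).ExteriorAlgebra

theorem exteriorPower_eq_zero_of_finrank_lt {K : Type*} [Field K] [Module K V] [Module.Finite K V]
    {k : ℕ} (hk : Module.finrank K V < k) (x : ⋀[K]^k V) : x = 0 := by
  have : Module.finrank K (⋀[K]^k V) = 0 := by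
    rw [exteriorPower.finrank_eq, Nat.choose_eq_zero_of_lt hk]
  exact Subsingleton.elim (h := Module.finrank_zero_iff.1 this) _ _

end ExteriorAlgebra

section Parity

open CliffordAlgebra (involute contractLeft)

variable {V : Type*} [AddCommGroup V] [Module ℝ V]

theorem mul_comm_of_parity {r s : ℤ} {x y : ExteriorAlgebra ℝ V} (hx : involute x = sgn r • x)
    (hy : involute y = sgn s • y) : x * y = sgn (r * s) • (y * x) := by
  rcases Int.even_or_odd s with h | h
  · have hs : sgn s = 1 := h.neg_one_zpow
    have hrs : sgn (r * s) = 1 := (h.mul_left r).neg_one_zpow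
    rw [hs, one_smul] at hy
    rw [hrs, one_smul, mul_comm_of_even hy]
  · have hs : sgn s = -1 := h.neg_one_zpow
    have hrs : sgn (r * s) = sgn r := by
      obtain ⟨k, rfl⟩ := h
      rw [show r * (2 * k + 1) = r * k + r * k + r by ring, sgn_add, sgn_add, sgn_mul_self, one_mul]
    rw [hs, neg_one_smul] at hy
    rw [hrs, mul_eq_involute_mul_of_odd hy, hx, smul_mul_assoc, smul_smul, sgn_mul_self, one_smul]

theorem involute_contractLeft_of_parity {r : ℤ} {x : ExteriorAlgebra ℝ V}
    (hx : involute x = sgn r • x) (e : Module.Dual ℝ V) :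
    involute (contractLeft e x) = sgn (r - 1) • contractLeft e x := by
  rw [involute_contractLeft, hx, map_smul, sgn_sub, sgn_one, mul_neg_one, neg_smul]

end Parity

section Total

open CliffordAlgebra (involute)

variable {K V W : Type*} [Field K] [AddCommGroup V] [Module K V] [AddCommGroup W] [Module K W]
  [Module.Finite K V] [Module.Finite K W]

/-- The multivector `∑ X r` with prescribed homogeneous components `X r`; the inverse map sends a
multivector to its homogeneous components. The sum stops at the dimension, above which all exterior
powers vanish. -/
def total : ((r : ℕ) → ⋀[K]^r V) ≃ₗ[K] ExteriorAlgebra K V where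
  toFun X := ∑ r ∈ Finset.range (Module.finrank K V + 1), (X r : ExteriorAlgebra K V)
  map_add' X Y := by simp only [Pi.add_apply, Submodule.coe_add, Finset.sum_add_distrib]
  map_smul' c X := by
    simp only [Pi.smul_apply, Submodule.coe_smul, Finset.smul_sum, RingHom.id_apply]
  invFun x r := DirectSum.decompose (fun r => ⋀[K]^r V) x r
  left_inv X := by
    funext k
    beta_reduce
    rw [DirectSum.decompose_sum, DFinsupp.finsetSum_apply]
    by_cases hk : k < Module.finrank K V + 1
    · rw [Finset.sum_eq_single k, DirectSum.decompose_coe, DirectSum.of_eq_same]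
      · intro r _ hr
        rw [DirectSum.decompose_coe, DirectSum.of_eq_of_ne _ _ _ hr.symm]
      · exact fun h => absurd (Finset.mem_range.2 hk) h
    · rw [exteriorPower_eq_zero_of_finrank_lt (by omega) (X k)]
      exact exteriorPower_eq_zero_of_finrank_lt (by omega) _
  right_inv x := by
    classical
    conv_rhs => rw [← DirectSum.sum_support_decompose (fun r => ⋀[K]^r V) x]
    refine (Finset.sum_subset (fun r hr => ?_) fun r _ hr => ?_).symm
    · by_contra h
      rw [Finset.mem_range] at h
      exact DFinsupp.mem_support_iff.1 hr (exteriorPower_eq_zero_of_finrank_lt (by omega) _)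
    · beta_reduce
      rw [DFinsupp.notMem_support_iff.1 hr, ZeroMemClass.coe_zero]

theorem total_apply (X : (r : ℕ) → ⋀[K]^r V) :
    total X = ∑ r ∈ Finset.range (Module.finrank K V + 1), (X r : ExteriorAlgebra K V) := rfl

theorem total_map (f : V →ₗ[K] W) (h : Module.finrank K V = Module.finrank K W)
    (X : (r : ℕ) → ⋀[K]^r V) :
    total (fun r => exteriorPower.map r f (X r)) = ExteriorAlgebra.map f (total X) := by
  simp only [total_apply, map_sum, coe_exteriorPower_map, h]

theorem total_neg_one_pow (X : (r : ℕ) → ⋀[K]^r V) :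
    total (fun r => (-1 : K) ^ r • X r) = involute (total X) := by
  simp only [total_apply, map_sum]
  refine Finset.sum_congr rfl fun r _ => ?_
  rw [involute_of_mem (X r).2, Submodule.coe_smul]

end Total

section Pairing

open CliffordAlgebra (involute)
open ExteriorAlgebra (ιMulti)

variable {V W : Type*} [AddCommGroup V] [Module ℝ V] [TopologicalSpace V]
  [AddCommGroup W] [Module ℝ W] [TopologicalSpace W]

/-- A family of alternating forms as a linear functional on the exterior algebra, taking the value
`α k v` at `v₁ ∧ ⋯ ∧ v_k`. -/
def pairing : ((r : ℕ) → V [⋀^Fin r]→L[ℝ] ℝ) →ₗ[ℝ] Module.Dual ℝ (ExteriorAlgebra ℝ V) where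
  toFun α := ExteriorAlgebra.liftAlternating fun r => (α r).toAlternatingMap
  map_add' α β := linearMap_ext_ιMulti fun k v => by
    simp only [LinearMap.add_apply, ExteriorAlgebra.liftAlternating_apply_ιMulti]
    rfl
  map_smul' c α := linearMap_ext_ιMulti fun k v => by
    simp only [LinearMap.smul_apply, ExteriorAlgebra.liftAlternating_apply_ιMulti]
    rfl

@[simp]
theorem pairing_ιMulti (α : (r : ℕ) → V [⋀^Fin r]→L[ℝ] ℝ) {k : ℕ} (v : Fin k → V) :
    pairing α (ιMulti ℝ k v) = α k v :=
  ExteriorAlgebra.liftAlternating_apply_ιMulti _ _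

theorem pairing_neg_one_pow (α : (r : ℕ) → V [⋀^Fin r]→L[ℝ] ℝ) (x : ExteriorAlgebra ℝ V) :
    pairing (fun r => (-1 : ℝ) ^ r • α r) x = pairing α (involute x) := by
  have : pairing (fun r => (-1 : ℝ) ^ r • α r) = pairing α ∘ₗ involute.toLinearMap :=
    linearMap_ext_ιMulti fun k v => by
      simp only [LinearMap.comp_apply, AlgHom.toLinearMap_apply, involute_ιMulti, map_smul,
        pairing_ιMulti, ContinuousAlternatingMap.smul_apply]
  exact LinearMap.congr_fun this x

theorem pairing_compContinuousLinearMap (α : (r : ℕ) → V [⋀^Fin r]→L[ℝ] ℝ) (f : W →L[ℝ] V)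
    (z : ExteriorAlgebra ℝ W) :
    pairing (fun r => (α r).compContinuousLinearMap f) z
      = pairing α (ExteriorAlgebra.map f.toLinearMap z) := by
  have : pairing (fun r => (α r).compContinuousLinearMap f)
      = pairing α ∘ₗ (ExteriorAlgebra.map f.toLinearMap).toLinearMap :=
    linearMap_ext_ιMulti fun k v => by
      simp only [LinearMap.comp_apply, AlgHom.toLinearMap_apply, ExteriorAlgebra.map_apply_ιMulti,
        pairing_ιMulti]
      rfl
  exact LinearMap.congr_fun this z

theorem contract_apply (α : (r : ℕ) → V [⋀^Fin r]→L[ℝ] ℝ) {r k : ℕ} (x : ⋀[ℝ]^r V)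
    (v : Fin k → V) :
    contract x (α (r + k)) v = pairing α (x * ιMulti ℝ k v) := by
  let evalAt : (V [⋀^Fin k]→L[ℝ] ℝ) →ₗ[ℝ] ℝ :=
    { toFun := fun β => β v, map_add' := fun _ _ => rfl, map_smul' := fun _ _ => rfl }
  have : evalAt ∘ₗ exteriorPower.alternatingMapLinearEquiv (contractAlternating (α (r + k)))
      = pairing α ∘ₗ LinearMap.mulRight ℝ (ιMulti ℝ k v) ∘ₗ (⋀[ℝ]^r V).subtype := by
    apply exteriorPower.linearMap_ext
    ext w
    simp only [LinearMap.compAlternatingMap_apply, LinearMap.comp_apply, Submodule.subtype_apply,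
      exteriorPower.ιMulti_apply_coe, LinearMap.mulRight_apply, ExteriorAlgebra.ιMulti_mul_ιMulti,
      pairing_ιMulti, exteriorPower.alternatingMapLinearEquiv_apply_ιMulti]
    rfl
  exact LinearMap.congr_fun this x

theorem pairing_contract [Module.Finite ℝ V] (X : (r : ℕ) → ⋀[ℝ]^r V)
    (α : (r : ℕ) → V [⋀^Fin r]→L[ℝ] ℝ) (z : ExteriorAlgebra ℝ V) :
    pairing (fun k => ∑ r ∈ Finset.range (Module.finrank ℝ V + 1), contract (X r) (α (r + k))) z
      = pairing α (total X * z) := by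
  have : pairing (fun k => ∑ r ∈ Finset.range (Module.finrank ℝ V + 1),
      contract (X r) (α (r + k))) = pairing α ∘ₗ LinearMap.mulLeft ℝ (total X) :=
    linearMap_ext_ιMulti fun k v => by
      rw [pairing_ιMulti, LinearMap.comp_apply, LinearMap.mulLeft_apply, total_apply,
        Finset.sum_mul, map_sum, ContinuousAlternatingMap.sum_apply]
      exact Finset.sum_congr rfl fun r _ => contract_apply α (X r) v
  exact LinearMap.congr_fun this z

end Pairing

/-! ### Calculus with values in the exterior algebra -/

section Calculus

open CliffordAlgebra (involute contractLeft)
open ExteriorAlgebra (ιMulti)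

variable {E F : Type*} [NormedAddCommGroup E] [NormedSpace ℝ E] [FiniteDimensional ℝ E]
  [NormedAddCommGroup F] [NormedSpace ℝ F] [FiniteDimensional ℝ F]

/-- A norm on the exterior algebra, which makes multivector fields on `E` differentiable functions.
It is the sup norm of the coordinates in some basis; all norms being equivalent, the choice does
not matter. -/
instance normedAddCommGroupExteriorAlgebra : NormedAddCommGroup (ExteriorAlgebra ℝ E) :=
  .induced _ _ (Module.finBasis ℝ (ExteriorAlgebra ℝ E)).equivFun.toLinearMap
    (LinearEquiv.injective _)

instance normedSpaceExteriorAlgebra : NormedSpace ℝ (ExteriorAlgebra ℝ E) :=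
  .induced ℝ _ _ (Module.finBasis ℝ (ExteriorAlgebra ℝ E)).equivFun.toLinearMap

/-- The wedge product as a continuous bilinear map. -/
def wedge : ExteriorAlgebra ℝ E →L[ℝ] ExteriorAlgebra ℝ E →L[ℝ] ExteriorAlgebra ℝ E :=
  (LinearMap.toContinuousLinearMap.toLinearMap ∘ₗ
    LinearMap.mul ℝ (ExteriorAlgebra ℝ E)).toContinuousLinearMap

@[simp]
theorem wedge_apply (x y : ExteriorAlgebra ℝ E) : wedge x y = x * y := rfl

/-- The map of exterior algebras induced by a linear map, as a continuous linear map. -/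
def exteriorMap (f : E →L[ℝ] F) : ExteriorAlgebra ℝ E →L[ℝ] ExteriorAlgebra ℝ F :=
  (ExteriorAlgebra.map f.toLinearMap).toLinearMap.toContinuousLinearMap

theorem exteriorMap_apply (f : E →L[ℝ] F) (x : ExteriorAlgebra ℝ E) :
    exteriorMap f x = ExteriorAlgebra.map f.toLinearMap x := rfl

theorem exteriorMap_mul (f : E →L[ℝ] F) (x y : ExteriorAlgebra ℝ E) :
    exteriorMap f (x * y) = exteriorMap f x * exteriorMap f y :=
  map_mul (ExteriorAlgebra.map f.toLinearMap) x y

theorem exteriorMap_comp {G : Type*} [NormedAddCommGroup G] [NormedSpace ℝ G]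
    [FiniteDimensional ℝ G] (g : F →L[ℝ] G) (f : E →L[ℝ] F) :
    exteriorMap (g ∘L f) = exteriorMap g ∘L exteriorMap f := by
  ext x
  simp only [ContinuousLinearMap.comp_apply, exteriorMap_apply,
    ContinuousLinearMap.toLinearMap_comp, ← ExteriorAlgebra.map_comp_map, AlgHom.comp_apply]

theorem exteriorMap_id :
    exteriorMap (.id ℝ E) = .id ℝ (ExteriorAlgebra ℝ E) := by
  ext x
  exact AlgHom.congr_fun (ExteriorAlgebra.map_id (R := ℝ) (M := E)) x

theorem continuous_ιMulti (k : ℕ) :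
    Continuous fun v : Fin k → E => (ιMulti ℝ k v : ExteriorAlgebra ℝ E) := by
  induction k with
  | zero => simpa only [ExteriorAlgebra.ιMulti_zero_apply] using continuous_const
  | succ k ih =>
    have head : Continuous fun v : Fin (k + 1) → E => ExteriorAlgebra.ι ℝ (v 0) :=
      (ExteriorAlgebra.ι ℝ (M := E)).continuous_of_finiteDimensional.comp (continuous_apply 0)
    have tail : Continuous fun v : Fin (k + 1) → E => Matrix.vecTail v :=
      continuous_pi fun j => continuous_apply j.succ
    simp only [ExteriorAlgebra.ιMulti_succ_apply]
    exact (wedge.continuous.comp head).clm_apply (ih.comp tail)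

/-- Families of alternating forms on `E` are the same as linear functionals on the exterior
algebra: `pairing`, with continuity built in. -/
def pairingEquiv :
    ((r : ℕ) → E [⋀^Fin r]→L[ℝ] ℝ) ≃ₗ[ℝ] (ExteriorAlgebra ℝ E →L[ℝ] ℝ) where
  toLinearMap := LinearMap.toContinuousLinearMap.toLinearMap ∘ₗ pairing
  invFun A r :=
    { A.toLinearMap.compAlternatingMap (ιMulti ℝ r) with
      cont := A.continuous.comp (continuous_ιMulti r) }
  left_inv α := by
    funext r
    ext v
    exact pairing_ιMulti α v
  right_inv A := ContinuousLinearMap.coe_injective <|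
    linearMap_ext_ιMulti fun _ v => pairing_ιMulti _ v

@[simp]
theorem pairingEquiv_apply (α : (r : ℕ) → E [⋀^Fin r]→L[ℝ] ℝ) (z : ExteriorAlgebra ℝ E) :
    pairingEquiv α z = pairing α z := rfl

/-- The homogeneous component of degree `r` of a functional on the exterior algebra. -/
def alternatingPart (r : ℕ) : (ExteriorAlgebra ℝ E →L[ℝ] ℝ) →L[ℝ] (E [⋀^Fin r]→L[ℝ] ℝ) :=
  (LinearMap.proj r ∘ₗ pairingEquiv.symm.toLinearMap).toContinuousLinearMap

theorem alternatingPart_pairingEquiv (r : ℕ) (α : (r : ℕ) → E [⋀^Fin r]→L[ℝ] ℝ) :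
    alternatingPart r (pairingEquiv α) = α r :=
  congrFun (pairingEquiv.symm_apply_apply α) r

theorem alternating_eq_zero_of_finrank_lt {r : ℕ} (hr : Module.finrank ℝ E < r)
    (α : E [⋀^Fin r]→L[ℝ] ℝ) : α = 0 := by
  ext v
  exact α.toAlternatingMap.map_linearDependent v fun hv => by
    simpa using hv.fintype_card_le_finrank.trans_lt hr

instance finite_continuousAlternatingMap (r : ℕ) : Module.Finite ℝ (E [⋀^Fin r]→L[ℝ] ℝ) :=
  .of_surjective (alternatingPart r).toLinearMap fun α =>
    ⟨pairingEquiv (Pi.single r α), by simp [alternatingPart_pairingEquiv]⟩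

theorem pairingEquiv_eq_sum (α : (r : ℕ) → E [⋀^Fin r]→L[ℝ] ℝ) :
    pairingEquiv α = ∑ r ∈ Finset.range (Module.finrank ℝ E + 1),
      (pairingEquiv.toLinearMap ∘ₗ LinearMap.single ℝ _ r).toContinuousLinearMap (α r) := by
  have : α = ∑ r ∈ Finset.range (Module.finrank ℝ E + 1), Pi.single r (α r) := by
    funext k
    rw [Finset.sum_apply]
    by_cases hk : k < Module.finrank ℝ E + 1
    · rw [Finset.sum_eq_single k (fun r _ hr => Pi.single_eq_of_ne hr.symm _)
        (fun h => absurd (Finset.mem_range.2 hk) h), Pi.single_eq_same]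
    · rw [alternating_eq_zero_of_finrank_lt (by omega) (α k)]
      exact (alternating_eq_zero_of_finrank_lt (by omega) _).symm
  conv_lhs => rw [this, map_sum]
  rfl

theorem contDiffOn_pairingEquiv_iff {α : E → (r : ℕ) → E [⋀^Fin r]→L[ℝ] ℝ} {n : WithTop ℕ∞}
    {U : Set E} :
    ContDiffOn ℝ n (fun y => pairingEquiv (α y)) U ↔ ∀ r, ContDiffOn ℝ n (fun y => α y r) U := by
  refine ⟨fun h r => ?_, fun h => ?_⟩
  · simpa only [Function.comp_def, alternatingPart_pairingEquiv] using
      (alternatingPart r).contDiff.comp_contDiffOn h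
  · simp only [pairingEquiv_eq_sum]
    exact ContDiffOn.sum fun r _ => ContinuousLinearMap.contDiff _ |>.comp_contDiffOn (h r)

theorem differentiableAt_pairingEquiv_iff {α : E → (r : ℕ) → E [⋀^Fin r]→L[ℝ] ℝ} {y : E} :
    DifferentiableAt ℝ (fun y => pairingEquiv (α y)) y
      ↔ ∀ r, DifferentiableAt ℝ (fun y => α y r) y := by
  refine ⟨fun h r => ?_, fun h => ?_⟩
  · simpa only [Function.comp_def, alternatingPart_pairingEquiv] using
      (alternatingPart r).differentiableAt.comp y h
  · simp only [pairingEquiv_eq_sum]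
    exact DifferentiableAt.fun_sum fun r _ =>
      (ContinuousLinearMap.differentiableAt _).comp y (h r)

/-- The exterior derivative of a form on `E`, the form being given as a function with values in
the dual of the exterior algebra: in coordinates, `d = ∑ dxⁱ ∧ ∂ᵢ`, and the transpose of `dxⁱ ∧ ·`
is the contraction with `dxⁱ`. -/
def exteriorDeriv (A : E → ExteriorAlgebra ℝ E →L[ℝ] ℝ) (y : E) : ExteriorAlgebra ℝ E →L[ℝ] ℝ :=
  ∑ i, fderiv ℝ A y (Module.finBasis ℝ E i) ∘L
    (contractLeft ((Module.finBasis ℝ E).coord i)).toContinuousLinearMap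

theorem exteriorDeriv_apply (A : E → ExteriorAlgebra ℝ E →L[ℝ] ℝ) (y : E)
    (z : ExteriorAlgebra ℝ E) :
    exteriorDeriv A y z = ∑ i, fderiv ℝ A y (Module.finBasis ℝ E i)
      (contractLeft ((Module.finBasis ℝ E).coord i) z) := by
  simp [exteriorDeriv]

theorem exteriorDeriv_congr {A B : E → ExteriorAlgebra ℝ E →L[ℝ] ℝ} {y : E}
    (h : A =ᶠ[nhds y] B) : exteriorDeriv A y = exteriorDeriv B y := by
  simp only [exteriorDeriv, h.fderiv_eq]

theorem exteriorDeriv_add {A B : E → ExteriorAlgebra ℝ E →L[ℝ] ℝ} {y : E}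
    (hA : DifferentiableAt ℝ A y) (hB : DifferentiableAt ℝ B y) :
    exteriorDeriv (A + B) y = exteriorDeriv A y + exteriorDeriv B y := by
  simp only [exteriorDeriv, fderiv_add hA hB, add_apply, ContinuousLinearMap.add_comp,
    Finset.sum_add_distrib]

theorem exteriorDeriv_const_smul (c : ℝ) (A : E → ExteriorAlgebra ℝ E →L[ℝ] ℝ) (y : E) :
    exteriorDeriv (c • A) y = c • exteriorDeriv A y := by
  simp only [exteriorDeriv, Finset.smul_sum]
  have h : fderiv ℝ (c • A) y = c • fderiv ℝ A y :=
    congrFun (fderiv_const_smul_field (𝕜 := ℝ) (f := A) c) y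
  rw [h]
  rfl

/-- The degreewise exterior derivative of a family of alternating forms. -/
def familyDeriv (α : E → (r : ℕ) → E [⋀^Fin r]→L[ℝ] ℝ) (y : E) : (r : ℕ) → E [⋀^Fin r]→L[ℝ] ℝ
  | 0 => 0
  | r + 1 => extDeriv (fun y => α y r) y

theorem fderiv_pairingEquiv_ιMulti {α : E → (r : ℕ) → E [⋀^Fin r]→L[ℝ] ℝ} {y : E}
    (h : ∀ r, DifferentiableAt ℝ (fun y => α y r) y) (v : E) {k : ℕ} (w : Fin k → E) :
    fderiv ℝ (fun y => pairingEquiv (α y)) y v (ιMulti ℝ k w)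
      = fderiv ℝ (fun y => α y k w) y v := by
  have hA := (differentiableAt_pairingEquiv_iff.2 h).hasFDerivAt.clm_apply
    (hasFDerivAt_const (ιMulti ℝ k w : ExteriorAlgebra ℝ E) y)
  simp only [pairingEquiv_apply, pairing_ιMulti] at hA
  simp [hA.fderiv]

theorem exteriorDeriv_pairingEquiv {α : E → (r : ℕ) → E [⋀^Fin r]→L[ℝ] ℝ} {y : E}
    (h : ∀ r, DifferentiableAt ℝ (fun y => α y r) y) :
    exteriorDeriv (fun y => pairingEquiv (α y)) y = pairingEquiv (familyDeriv α y) := by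
  refine ContinuousLinearMap.coe_injective (linearMap_ext_ιMulti fun k v => ?_)
  simp only [ContinuousLinearMap.coe_coe, pairingEquiv_apply, pairing_ιMulti, exteriorDeriv_apply]
  cases k with
  | zero =>
    refine Finset.sum_eq_zero fun i _ => ?_
    rw [ExteriorAlgebra.ιMulti_zero_apply, CliffordAlgebra.contractLeft_one, map_zero]
  | succ k =>
    have expand (j : Fin (k + 1)) : v j
        = ∑ i, (Module.finBasis ℝ E).coord i (v j) • Module.finBasis ℝ E i := by simp
    simp only [familyDeriv, extDeriv_apply (h k), contractLeft_ιMulti, map_sum, map_smul,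
      fderiv_pairingEquiv_ιMulti h]
    rw [Finset.sum_comm]
    refine Finset.sum_congr rfl fun j _ => ?_
    conv_rhs => rw [expand j, map_sum, Finset.smul_sum]
    simp only [map_smul, smul_eq_mul, mul_assoc, zsmul_eq_mul, Int.cast_pow, Int.cast_neg,
      Int.cast_one]

theorem pairingEquiv_compContinuousLinearMap (α : (r : ℕ) → F [⋀^Fin r]→L[ℝ] ℝ) (f : E →L[ℝ] F) :
    pairingEquiv (fun r => (α r).compContinuousLinearMap f) = pairingEquiv α ∘L exteriorMap f :=
  ContinuousLinearMap.ext (pairing_compContinuousLinearMap α f)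

/-- The pullback of a form along a map. -/
def pullback (φ : E → F) (A : F → ExteriorAlgebra ℝ F →L[ℝ] ℝ) (y : E) :
    ExteriorAlgebra ℝ E →L[ℝ] ℝ :=
  A (φ y) ∘L exteriorMap (fderiv ℝ φ y)

theorem pullback_pairingEquiv (φ : E → F) (α : F → (r : ℕ) → F [⋀^Fin r]→L[ℝ] ℝ) :
    pullback φ (fun y => pairingEquiv (α y)) =
      fun y => pairingEquiv fun r => (α (φ y) r).compContinuousLinearMap (fderiv ℝ φ y) := by
  funext y
  rw [pullback, pairingEquiv_compContinuousLinearMap]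

theorem exists_eq_pairingEquiv (A : E → ExteriorAlgebra ℝ E →L[ℝ] ℝ) :
    ∃ α : E → (r : ℕ) → E [⋀^Fin r]→L[ℝ] ℝ, A = fun y => pairingEquiv (α y) :=
  ⟨fun y => pairingEquiv.symm (A y), by simp⟩

theorem differentiableAt_pullback {A : F → ExteriorAlgebra ℝ F →L[ℝ] ℝ} {φ : E → F} {y : E}
    (hA : DifferentiableAt ℝ A (φ y)) (hφ : ContDiffAt ℝ 2 φ y) :
    DifferentiableAt ℝ (pullback φ A) y := by
  obtain ⟨α, rfl⟩ := exists_eq_pairingEquiv A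
  have hφ' : DifferentiableAt ℝ (fderiv ℝ φ) y :=
    (hφ.fderiv_right (m := 1) (by norm_num)).differentiableAt one_ne_zero
  rw [pullback_pairingEquiv, differentiableAt_pairingEquiv_iff]
  exact fun r => (((differentiableAt_pairingEquiv_iff.1 hA r).comp y
    (hφ.differentiableAt two_ne_zero))).continuousAlternatingMapCompContinuousLinearMap hφ'

theorem exteriorDeriv_pullback {A : F → ExteriorAlgebra ℝ F →L[ℝ] ℝ} {φ : E → F} {y : E}
    (hA : DifferentiableAt ℝ A (φ y)) (hφ : ContDiffAt ℝ 2 φ y) :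
    exteriorDeriv (pullback φ A) y = pullback φ (exteriorDeriv A) y := by
  have hφA := differentiableAt_pullback hA hφ
  obtain ⟨α, rfl⟩ := exists_eq_pairingEquiv A
  rw [pullback_pairingEquiv] at hφA ⊢
  rw [exteriorDeriv_pairingEquiv (differentiableAt_pairingEquiv_iff.1 hφA), pullback,
    exteriorDeriv_pairingEquiv (differentiableAt_pairingEquiv_iff.1 hA),
    ← pairingEquiv_compContinuousLinearMap]
  congr 1
  funext r
  cases r with
  | zero => rfl
  | succ r =>
    exact extDeriv_pullback (differentiableAt_pairingEquiv_iff.1 hA r) hφ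
      minSmoothness_of_isRCLikeNormedField.le

theorem contDiffOn_exteriorDeriv {A : E → ExteriorAlgebra ℝ E →L[ℝ] ℝ} {U : Set E}
    (hU : IsOpen U) (hA : ContDiffOn ℝ (⊤ : ℕ∞) A U) :
    ContDiffOn ℝ (⊤ : ℕ∞) (exteriorDeriv A) U := by
  unfold exteriorDeriv
  exact ContDiffOn.sum fun i _ => ContDiffOn.clm_comp
    ((hA.fderiv_of_isOpen hU (m := (⊤ : ℕ∞)) le_rfl).clm_apply contDiffOn_const) contDiffOn_const

theorem exteriorDeriv_exteriorDeriv {A : E → ExteriorAlgebra ℝ E →L[ℝ] ℝ} {U : Set E}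
    (hU : IsOpen U) (hA : ContDiffOn ℝ (⊤ : ℕ∞) A U) {y : E} (hy : y ∈ U) :
    exteriorDeriv (exteriorDeriv A) y = 0 := by
  have diff_exteriorDeriv : DifferentiableAt ℝ (exteriorDeriv A) y :=
    ((contDiffOn_exteriorDeriv hU hA).contDiffAt (hU.mem_nhds hy)).differentiableAt (by simp)
  obtain ⟨α, rfl⟩ := exists_eq_pairingEquiv A
  have smooth (r : ℕ) := contDiffOn_pairingEquiv_iff.1 hA r
  have eq_familyDeriv : exteriorDeriv (fun y => pairingEquiv (α y))
      =ᶠ[nhds y] fun y => pairingEquiv (familyDeriv α y) := by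
    filter_upwards [hU.mem_nhds hy] with x hx
    exact exteriorDeriv_pairingEquiv fun r =>
      ((smooth r).contDiffAt (hU.mem_nhds hx)).differentiableAt (by simp)
  rw [exteriorDeriv_congr eq_familyDeriv, exteriorDeriv_pairingEquiv
    (differentiableAt_pairingEquiv_iff.1 (diff_exteriorDeriv.congr_of_eventuallyEq
      eq_familyDeriv.symm)), ← map_zero pairingEquiv]
  congr 1
  funext r
  match r with
  | 0 => rfl
  | 1 =>
    have : extDeriv (0 : E → E [⋀^Fin 0]→L[ℝ] ℝ) y = 0 := by
      simpa using extDeriv_smul (0 : ℝ) (0 : E → E [⋀^Fin 0]→L[ℝ] ℝ) (x := y)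
    exact this
  | r + 2 =>
    exact extDeriv_extDeriv_apply (ω := fun y => α y r) ((smooth r).contDiffAt (hU.mem_nhds hy))
      (minSmoothness_of_isRCLikeNormedField.le.trans (WithTop.coe_le_coe.2 le_top))

end Calculus

/-! ### The Schouten bracket in coordinates -/

section LocalBracket

open CliffordAlgebra (involute contractLeft)

section Algebra

variable {V : Type*} [AddCommGroup V] [Module ℝ V] {r s : ℤ} {x y : ExteriorAlgebra ℝ V}

theorem mul_contractLeft_sub_of_parity (hx : involute x = sgn r • x) (e : Module.Dual ℝ V)
    (z : ExteriorAlgebra ℝ V) :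
    x * contractLeft e z - sgn r • contractLeft e (x * z) = -sgn r • (contractLeft e x * z) := by
  rw [contractLeft_mul, hx, smul_add, smul_mul_assoc, smul_smul, sgn_mul_self]
  module

theorem mul_mul_contractLeft_sub_of_parity (hx : involute x = sgn r • x)
    (hy : involute y = sgn s • y) (e : Module.Dual ℝ V) (z : ExteriorAlgebra ℝ V) :
    y * (x * contractLeft e z) - sgn ((r - 1) * s) • (x * contractLeft e (y * z))
      = -sgn ((r - 1) * s) • (x * (contractLeft e y * z)) := by
  have signs : sgn ((r - 1) * s) = sgn (s * r) * sgn s := by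
    rw [sub_mul, one_mul, sgn_sub, mul_comm r]
  rw [contractLeft_mul, hy, ← mul_assoc y, mul_comm_of_parity hy hx, signs, mul_add,
    smul_mul_assoc, smul_mul_assoc, mul_smul_comm, smul_add, smul_smul, mul_assoc (sgn _),
    sgn_mul_self, mul_one, mul_assoc x]
  module

theorem contractLeft_mul_comm_of_parity (hx : involute x = sgn r • x)
    (hy : involute y = sgn s • y) (e : Module.Dual ℝ V) (z : ExteriorAlgebra ℝ V) :
    contractLeft e x * (y * z) = sgn ((r - 1) * s) • (y * (contractLeft e x * z)) := by
  rw [← mul_assoc, mul_comm_of_parity (involute_contractLeft_of_parity hx e) hy, smul_mul_assoc,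
    mul_assoc]

end Algebra

variable {E F : Type*} [NormedAddCommGroup E] [NormedSpace ℝ E] [FiniteDimensional ℝ E]
  [NormedAddCommGroup F] [NormedSpace ℝ F] [FiniteDimensional ℝ F]

/-- The contraction `i_X A` of a form on `E` along a multivector field: the transpose of the wedge
product with `X` from the left. -/
def interior (X : E → ExteriorAlgebra ℝ E) (A : E → ExteriorAlgebra ℝ E →L[ℝ] ℝ) (y : E) :
    ExteriorAlgebra ℝ E →L[ℝ] ℝ :=
  A y ∘L wedge (X y)

theorem interior_apply (X : E → ExteriorAlgebra ℝ E) (A : E → ExteriorAlgebra ℝ E →L[ℝ] ℝ) (y : E)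
    (z : ExteriorAlgebra ℝ E) : interior X A y z = A y (X y * z) := rfl

/-- The Lie derivative `L_X A = d i_X A - (-1)^r i_X d A` along a multivector field on `E` of
parity `r`. -/
def lieAlong (r : ℤ) (X : E → ExteriorAlgebra ℝ E) (A : E → ExteriorAlgebra ℝ E →L[ℝ] ℝ) (y : E) :
    ExteriorAlgebra ℝ E →L[ℝ] ℝ :=
  exteriorDeriv (interior X A) y - sgn r • interior X (exteriorDeriv A) y

/-- The Schouten bracket of two multivector fields on `E` of parities `r` and `s`. -/
def localBracket (r s : ℤ) (X Y : E → ExteriorAlgebra ℝ E) (y : E) : ExteriorAlgebra ℝ E :=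
  -∑ i, (sgn r • (fderiv ℝ Y y (Module.finBasis ℝ E i)
        * contractLeft ((Module.finBasis ℝ E).coord i) (X y))
      + sgn ((r - 1) * s) • (fderiv ℝ X y (Module.finBasis ℝ E i)
        * contractLeft ((Module.finBasis ℝ E).coord i) (Y y)))

theorem lieAlong_congr (r : ℤ) (X : E → ExteriorAlgebra ℝ E)
    {A B : E → ExteriorAlgebra ℝ E →L[ℝ] ℝ} {y : E} (h : A =ᶠ[nhds y] B) :
    lieAlong r X A y = lieAlong r X B y := by
  have hX : interior X A =ᶠ[nhds y] interior X B :=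
    h.mono fun x hx => by rw [interior, hx, interior]
  rw [lieAlong, lieAlong, exteriorDeriv_congr hX, interior, interior, exteriorDeriv_congr h]

theorem differentiableAt_interior {X : E → ExteriorAlgebra ℝ E}
    {A : E → ExteriorAlgebra ℝ E →L[ℝ] ℝ} {y : E} (hX : DifferentiableAt ℝ X y)
    (hA : DifferentiableAt ℝ A y) : DifferentiableAt ℝ (interior X A) y :=
  hA.clm_comp ((wedge (E := E)).differentiableAt.comp y hX)

theorem fderiv_interior_apply {X : E → ExteriorAlgebra ℝ E}
    {A : E → ExteriorAlgebra ℝ E →L[ℝ] ℝ} {y : E} (hX : DifferentiableAt ℝ X y)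
    (hA : DifferentiableAt ℝ A y) (v : E) (z : ExteriorAlgebra ℝ E) :
    fderiv ℝ (interior X A) y v z = fderiv ℝ A y v (X y * z) + A y (fderiv ℝ X y v * z) := by
  have h : HasFDerivAt (interior X A) _ y :=
    hA.hasFDerivAt.clm_comp ((wedge (E := E)).hasFDerivAt.comp y hX.hasFDerivAt)
  rw [h.fderiv]
  simp [add_comm]

theorem involute_fderiv {r : ℤ} {X : E → ExteriorAlgebra ℝ E} {y : E}
    (hX : DifferentiableAt ℝ X y) (hr : ∀ᶠ x in nhds y, involute (X x) = sgn r • X x) (v : E) :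
    involute (fderiv ℝ X y v) = sgn r • fderiv ℝ X y v := by
  let inv : ExteriorAlgebra ℝ E →L[ℝ] ExteriorAlgebra ℝ E :=
    involute.toLinearMap.toContinuousLinearMap
  have h : HasFDerivAt (fun x => inv (X x)) (inv ∘L fderiv ℝ X y) y :=
    inv.hasFDerivAt.comp y hX.hasFDerivAt
  have h' : HasFDerivAt (fun x => inv (X x)) (sgn r • fderiv ℝ X y) y :=
    (hX.hasFDerivAt.const_smul (sgn r)).congr_of_eventuallyEq hr
  exact DFunLike.congr_fun (h.unique h') v

theorem involute_localBracket {r s : ℤ} {X Y : E → ExteriorAlgebra ℝ E} {y : E}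
    (hX : DifferentiableAt ℝ X y) (hY : DifferentiableAt ℝ Y y)
    (hr : ∀ᶠ x in nhds y, involute (X x) = sgn r • X x)
    (hs : ∀ᶠ x in nhds y, involute (Y x) = sgn s • Y x) :
    involute (localBracket r s X Y y) = sgn (r + s - 1) • localBracket r s X Y y := by
  simp only [localBracket, map_neg, map_sum, map_add, map_smul, map_mul, smul_neg, Finset.smul_sum]
  congr 1
  refine Finset.sum_congr rfl fun i _ => ?_
  rw [involute_fderiv hX hr, involute_fderiv hY hs,
    involute_contractLeft_of_parity hr.self_of_nhds,
    involute_contractLeft_of_parity hs.self_of_nhds]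
  simp only [smul_mul_smul_comm, smul_add, sgn_sub, sgn_add]
  module

theorem contDiffOn_localBracket (r s : ℤ) {X Y : E → ExteriorAlgebra ℝ E} {U : Set E}
    (hU : IsOpen U) (hX : ContDiffOn ℝ (⊤ : ℕ∞) X U) (hY : ContDiffOn ℝ (⊤ : ℕ∞) Y U) :
    ContDiffOn ℝ (⊤ : ℕ∞) (localBracket r s X Y) U := by
  have product {P Q : E → ExteriorAlgebra ℝ E} (hP : ContDiffOn ℝ (⊤ : ℕ∞) P U)
      (hQ : ContDiffOn ℝ (⊤ : ℕ∞) Q U) (v : E) (e : Module.Dual ℝ E) :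
      ContDiffOn ℝ (⊤ : ℕ∞) (fun y => fderiv ℝ P y v * contractLeft e (Q y)) U := by
    have hP' := (hP.fderiv_of_isOpen hU (m := (⊤ : ℕ∞)) le_rfl).clm_apply
      (contDiffOn_const (c := v))
    let ι_e := (contractLeft (Q := (0 : QuadraticForm ℝ E)) e).toContinuousLinearMap
    exact (wedge.contDiff.comp_contDiffOn hP').clm_apply (ι_e.contDiff.comp_contDiffOn hQ)
  exact ContDiffOn.neg (ContDiffOn.sum fun i _ =>
    ((product hY hX _ _).const_smul _).add ((product hX hY _ _).const_smul _))

/-- With `[a, b] = a b - (-1)^{|a||b|} b a`, this says `i_{[X, Y]} = [[d, i_X], i_Y]`. -/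
theorem lieAlong_interior_sub {r s : ℤ} {X Y : E → ExteriorAlgebra ℝ E}
    {A : E → ExteriorAlgebra ℝ E →L[ℝ] ℝ} {y : E}
    (hA : DifferentiableAt ℝ A y) (hX : DifferentiableAt ℝ X y) (hY : DifferentiableAt ℝ Y y)
    (hr : ∀ᶠ x in nhds y, involute (X x) = sgn r • X x) (hs : involute (Y y) = sgn s • Y y) :
    lieAlong r X (interior Y A) y - sgn ((r - 1) * s) • interior Y (lieAlong r X A) y
      = interior (localBracket r s X Y) A y := by
  ext z
  simp only [lieAlong, sub_apply, smul_apply,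
    interior_apply, exteriorDeriv_apply, fderiv_interior_apply hX (differentiableAt_interior hY hA),
    fderiv_interior_apply hX hA, fderiv_interior_apply hY hA, localBracket, neg_mul,
    Finset.sum_mul, map_neg, map_sum, smul_eq_mul, Finset.mul_sum, ← Finset.sum_sub_distrib,
    ← Finset.sum_neg_distrib]
  refine Finset.sum_congr rfl fun i _ => ?_
  set v := Module.finBasis ℝ E i
  set e := (Module.finBasis ℝ E).coord i
  have dA_X := congrArg (fun w => fderiv ℝ A y v (Y y * w))
    (mul_contractLeft_sub_of_parity hr.self_of_nhds e z)
  have dA_Y := congrArg (fderiv ℝ A y v)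
    (mul_contractLeft_sub_of_parity hr.self_of_nhds e (Y y * z))
  have dA_comm := congrArg (fderiv ℝ A y v)
    (contractLeft_mul_comm_of_parity hr.self_of_nhds hs e z)
  have dY := congrArg (fun w => A y (fderiv ℝ Y y v * w))
    (mul_contractLeft_sub_of_parity hr.self_of_nhds e z)
  have dX := congrArg (A y) (mul_mul_contractLeft_sub_of_parity (involute_fderiv hX hr v) hs e z)
  simp only [mul_sub, map_sub, mul_smul_comm, map_smul, smul_eq_mul, mul_add, add_mul, map_add,
    smul_mul_assoc, mul_assoc] at dA_X dA_Y dA_comm dY dX ⊢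
  linear_combination dA_X - sgn ((r - 1) * s) * dA_Y + dY + dX
    + sgn r * sgn ((r - 1) * s) * dA_comm
    + sgn r * fderiv ℝ A y v (Y y * (contractLeft e (X y) * z)) * sgn_mul_self ((r - 1) * s)

theorem pullback_interior {φ : E → F} {X : E → ExteriorAlgebra ℝ E} {X' : F → ExteriorAlgebra ℝ F}
    {y : E} (hX : X' (φ y) = exteriorMap (fderiv ℝ φ y) (X y))
    (A : F → ExteriorAlgebra ℝ F →L[ℝ] ℝ) :
    pullback φ (interior X' A) y = interior X (pullback φ A) y := by
  ext z
  simp only [pullback, interior, ContinuousLinearMap.comp_apply, wedge_apply, hX, exteriorMap_mul]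

theorem pullback_lieAlong {φ : E → F} {X : E → ExteriorAlgebra ℝ E} {X' : F → ExteriorAlgebra ℝ F}
    {y : E} {A : F → ExteriorAlgebra ℝ F →L[ℝ] ℝ} (r : ℤ) (hφ : ContDiffAt ℝ 2 φ y)
    (hX : ∀ᶠ x in nhds y, X' (φ x) = exteriorMap (fderiv ℝ φ x) (X x))
    (hX' : DifferentiableAt ℝ X' (φ y)) (hA : DifferentiableAt ℝ A (φ y)) :
    pullback φ (lieAlong r X' A) y = lieAlong r X (pullback φ A) y := by
  have h : interior X (pullback φ A) =ᶠ[nhds y] pullback φ (interior X' A) :=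
    hX.mono fun x hx => (pullback_interior hx A).symm
  rw [lieAlong, exteriorDeriv_congr h, exteriorDeriv_pullback (differentiableAt_interior hX' hA) hφ,
    interior, exteriorDeriv_pullback hA hφ, ← interior, ← pullback_interior hX.self_of_nhds]
  rfl

/-- The bracket is determined by its action on constant forms, on which `lieAlong_interior_sub`
expresses it by operations that commute with pullbacks. -/
theorem localBracket_map {r s : ℤ} {φ : E → F} {X Y : E → ExteriorAlgebra ℝ E}
    {X' Y' : F → ExteriorAlgebra ℝ F} {y : E} (hφ : ContDiffAt ℝ 2 φ y)
    (relX : ∀ᶠ x in nhds y, X' (φ x) = exteriorMap (fderiv ℝ φ x) (X x))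
    (relY : ∀ᶠ x in nhds y, Y' (φ x) = exteriorMap (fderiv ℝ φ x) (Y x))
    (hX : DifferentiableAt ℝ X y) (hY : DifferentiableAt ℝ Y y)
    (hX' : DifferentiableAt ℝ X' (φ y)) (hY' : DifferentiableAt ℝ Y' (φ y))
    (hr : ∀ᶠ x in nhds y, involute (X x) = sgn r • X x) (hs : involute (Y y) = sgn s • Y y)
    (hr' : ∀ᶠ x in nhds (φ y), involute (X' x) = sgn r • X' x)
    (hs' : involute (Y' (φ y)) = sgn s • Y' (φ y)) :
    localBracket r s X' Y' (φ y) = exteriorMap (fderiv ℝ φ y) (localBracket r s X Y y) := by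
  refine Module.eval_apply_injective ℝ (LinearMap.ext fun a => ?_)
  let A : F → ExteriorAlgebra ℝ F →L[ℝ] ℝ := fun _ => a.toContinuousLinearMap
  have hA : DifferentiableAt ℝ A (φ y) := differentiableAt_const _
  have h : pullback φ (interior Y' A) =ᶠ[nhds y] interior Y (pullback φ A) :=
    relY.mono fun x hx => pullback_interior hx A
  have key : pullback φ (interior (localBracket r s X' Y') A) y
      = interior (localBracket r s X Y) (pullback φ A) y := by
    rw [← lieAlong_interior_sub (differentiableAt_pullback hA hφ) hX hY hr hs,
      ← lieAlong_congr r X h, ← pullback_lieAlong r hφ relX hX' (differentiableAt_interior hY' hA),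
      interior, ← pullback_lieAlong r hφ relX hX' hA, ← interior,
      ← pullback_interior relY.self_of_nhds, pullback,
      ← lieAlong_interior_sub hA hX' hY' hr' hs']
    rfl
  simpa [pullback, interior, A, exteriorMap_apply] using DFunLike.congr_fun key 1

end LocalBracket

/-! ### Forms and multivector fields in charts -/

theorem contDiffOn_iff_forall_dual {V W : Type*} [NormedAddCommGroup V]
    [NormedSpace ℝ V] [NormedAddCommGroup W] [NormedSpace ℝ W]
    [FiniteDimensional ℝ W] {n : WithTop ℕ∞} {f : V → W} {U : Set V} :
    ContDiffOn ℝ n f U ↔ ∀ l : Module.Dual ℝ W, ContDiffOn ℝ n (fun y => l (f y)) U := by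
  refine ⟨fun h l => l.toContinuousLinearMap.contDiff.comp_contDiffOn h, fun h => ?_⟩
  rw [← (Module.finBasis ℝ W).equivFunL.comp_contDiffOn_iff, contDiffOn_pi]
  exact fun i => h ((Module.finBasis ℝ W).coord i)

section Charts

variable {E : Type u} [NormedAddCommGroup E] [NormedSpace ℝ E]
  {M : Type v} [TopologicalSpace M] [ChartedSpace E M]

/-- The derivative of the preferred chart at `x`, at the point `m`, as an endomorphism of the model
space. -/
def chartDeriv (x m : M) : E →L[ℝ] E :=
  mfderiv 𝓘(ℝ, E) 𝓘(ℝ, E) (extChartAt 𝓘(ℝ, E) x) m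

/-- The derivative of the inverse of the preferred chart at `x`, at the point `y`. -/
def chartSymmDeriv (x : M) (y : E) : E →L[ℝ] E :=
  mfderiv 𝓘(ℝ, E) 𝓘(ℝ, E) (extChartAt 𝓘(ℝ, E) x).symm y

/-- The coordinate change from the preferred chart at `x'` to the one at `x`. -/
def transition (x' x : M) : E → E := extChartAt 𝓘(ℝ, E) x ∘ (extChartAt 𝓘(ℝ, E) x').symm

theorem eventually_mem_overlap {x x' : M} {y : E} (hy : y ∈ (extChartAt 𝓘(ℝ, E) x').target)
    (hx : (extChartAt 𝓘(ℝ, E) x').symm y ∈ (extChartAt 𝓘(ℝ, E) x).source) :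
    ∀ᶠ y' in nhds y, y' ∈ (extChartAt 𝓘(ℝ, E) x').target ∧
      (extChartAt 𝓘(ℝ, E) x').symm y' ∈ (extChartAt 𝓘(ℝ, E) x).source :=
  .and ((isOpen_extChartAt_target x').mem_nhds hy)
    ((continuousAt_extChartAt_symm'' hy).eventually_mem
      ((isOpen_extChartAt_source x).mem_nhds hx))

theorem Form.isSmooth_zero : (0 : Form E M).IsSmooth :=
  fun _ _ => contDiffOn_const (c := 0)

variable [IsManifold 𝓘(ℝ, E) (⊤ : ℕ∞) M]

theorem chartDeriv_comp_chartSymmDeriv {x : M} {y : E} (hy : y ∈ (extChartAt 𝓘(ℝ, E) x).target) :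
    chartDeriv x ((extChartAt 𝓘(ℝ, E) x).symm y) ∘L chartSymmDeriv x y
      = ContinuousLinearMap.id ℝ E := by
  have := mfderiv_extChartAt_comp_mfderivWithin_extChartAt_symm (I := 𝓘(ℝ, E)) hy
  rw [ModelWithCorners.range_eq_univ, mfderivWithin_univ] at this
  exact this

theorem chartSymmDeriv_comp_chartDeriv {x m : M} (hm : m ∈ (extChartAt 𝓘(ℝ, E) x).source) :
    chartSymmDeriv x (extChartAt 𝓘(ℝ, E) x m) ∘L chartDeriv x m = ContinuousLinearMap.id ℝ E := by
  have := mfderivWithin_extChartAt_symm_comp_mfderiv_extChartAt (I := 𝓘(ℝ, E))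
    ((extChartAt 𝓘(ℝ, E) x).map_source hm)
  rw [ModelWithCorners.range_eq_univ, mfderivWithin_univ, (extChartAt 𝓘(ℝ, E) x).left_inv hm]
    at this
  exact this

theorem fderiv_transition {x x' : M} {y : E} (hy : y ∈ (extChartAt 𝓘(ℝ, E) x').target)
    (hx : (extChartAt 𝓘(ℝ, E) x').symm y ∈ (extChartAt 𝓘(ℝ, E) x).source) :
    fderiv ℝ (transition x' x) y
      = chartDeriv x ((extChartAt 𝓘(ℝ, E) x').symm y) ∘L chartSymmDeriv x' y := by
  have symm_mdiff : MDifferentiableAt 𝓘(ℝ, E) 𝓘(ℝ, E) (extChartAt 𝓘(ℝ, E) x').symm y := by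
    have := mdifferentiableWithinAt_extChartAt_symm (I := 𝓘(ℝ, E)) hy
    rwa [ModelWithCorners.range_eq_univ, mdifferentiableWithinAt_univ] at this
  have chart_mdiff : MDifferentiableAt 𝓘(ℝ, E) 𝓘(ℝ, E) (extChartAt 𝓘(ℝ, E) x)
      ((extChartAt 𝓘(ℝ, E) x').symm y) :=
    mdifferentiableAt_extChartAt (by rwa [extChartAt_source] at hx)
  rw [← mfderiv_eq_fderiv]
  exact mfderiv_comp y chart_mdiff symm_mdiff

theorem contDiffAt_transition {x x' : M} {y : E} (hy : y ∈ (extChartAt 𝓘(ℝ, E) x').target)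
    (hx : (extChartAt 𝓘(ℝ, E) x').symm y ∈ (extChartAt 𝓘(ℝ, E) x).source) :
    ContDiffAt ℝ 2 (transition x' x) y := by
  have := contDiffWithinAt_ext_coord_change (I := 𝓘(ℝ, E)) (n := (⊤ : ℕ∞)) x x' (y := y)
    ⟨hy, hx⟩
  rw [ModelWithCorners.range_eq_univ, contDiffWithinAt_univ] at this
  exact this.of_le (WithTop.coe_le_coe.2 (le_top (a := (2 : ℕ∞))))

end Charts

section LocalExpressions

open CliffordAlgebra (involute)

variable {E : Type u} [NormedAddCommGroup E] [NormedSpace ℝ E] [FiniteDimensional ℝ E]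
  {M : Type v} [TopologicalSpace M] [ChartedSpace E M]

/-- The components of a form at `m`, the tangent space being identified with the model space. -/
def Form.fiber (α : Form E M) (m : M) (r : ℕ) : E [⋀^Fin r]→L[ℝ] ℝ := α r m

/-- The components of a multivector field at `m`, the tangent space being identified with the model
space. -/
def Multivector.fiber (X : Multivector E M) (m : M) (r : ℕ) : ⋀[ℝ]^r E := X r m

/-- The value of a form at `m`, as a functional on the exterior algebra of the model space. -/
def Form.value (α : Form E M) (m : M) : ExteriorAlgebra ℝ E →L[ℝ] ℝ :=
  pairingEquiv (α.fiber m)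

/-- The value of a multivector field at `m`, in the exterior algebra of the model space. -/
def Multivector.value (X : Multivector E M) (m : M) : ExteriorAlgebra ℝ E :=
  total (X.fiber m)

/-- The expression of a form in the preferred chart at `x`. -/
def Form.loc (α : Form E M) (x : M) (y : E) : ExteriorAlgebra ℝ E →L[ℝ] ℝ :=
  α.value ((extChartAt 𝓘(ℝ, E) x).symm y) ∘L exteriorMap (chartSymmDeriv x y)

/-- The expression of a multivector field in the preferred chart at `x`. -/
def Multivector.loc (X : Multivector E M) (x : M) (y : E) : ExteriorAlgebra ℝ E :=
  exteriorMap (chartDeriv x ((extChartAt 𝓘(ℝ, E) x).symm y))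
    (X.value ((extChartAt 𝓘(ℝ, E) x).symm y))

/-- The parity operator on forms, multiplication by `(-1)^r` in tensor degree `r`. -/
def Form.flip (α : Form E M) : Form E M := fun r => (-1 : ℝ) ^ r • α r

/-- The parity operator on multivector fields, multiplication by `(-1)^r` in tensor degree `r`. -/
def Multivector.flip (X : Multivector E M) : Multivector E M := fun r => (-1 : ℝ) ^ r • X r

theorem Form.ext_value {α β : Form E M} (h : ∀ m, α.value m = β.value m) : α = β := by
  funext r m
  exact congrFun (pairingEquiv.injective (h m)) r

theorem Multivector.ext_value {X Y : Multivector E M} (h : ∀ m, X.value m = Y.value m) :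
    X = Y := by
  funext r m
  exact congrFun ((total (V := E)).injective (h m)) r

theorem Form.value_zero (m : M) : (0 : Form E M).value m = 0 :=
  map_zero pairingEquiv

theorem Form.value_add (α β : Form E M) (m : M) : (α + β).value m = α.value m + β.value m :=
  map_add pairingEquiv _ _

theorem Form.value_smul (c : ℝ) (α : Form E M) (m : M) : (c • α).value m = c • α.value m :=
  map_smul pairingEquiv c _

theorem Multivector.value_add (X Y : Multivector E M) (m : M) :
    (X + Y).value m = X.value m + Y.value m :=
  map_add (total (V := E)) _ _

theorem Multivector.value_smul (c : ℝ) (X : Multivector E M) (m : M) :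
    (c • X).value m = c • X.value m :=
  map_smul (total (V := E)) c _

theorem Form.value_flip_apply (α : Form E M) (m : M) (z : ExteriorAlgebra ℝ E) :
    α.flip.value m z = α.value m (involute z) :=
  pairing_neg_one_pow (α.fiber m) z

theorem Multivector.value_flip (X : Multivector E M) (m : M) :
    X.flip.value m = involute (X.value m) :=
  total_neg_one_pow (X.fiber m)

theorem Form.value_contract_apply (X : Multivector E M) (α : Form E M) (m : M)
    (z : ExteriorAlgebra ℝ E) : (Form.contract X α).value m z = α.value m (X.value m * z) :=
  pairing_contract (X.fiber m) (α.fiber m) z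

theorem Form.contract_add (X : Multivector E M) (α β : Form E M) :
    Form.contract X (α + β) = Form.contract X α + Form.contract X β :=
  Form.ext_value fun m => by
    ext z; simp only [Form.value_contract_apply, Form.value_add, add_apply]

theorem Form.contract_smul (X : Multivector E M) (c : ℝ) (α : Form E M) :
    Form.contract X (c • α) = c • Form.contract X α :=
  Form.ext_value fun m => by
    ext z; simp only [Form.value_contract_apply, Form.value_smul, smul_apply]

theorem Form.add_contract (X Y : Multivector E M) (α : Form E M) :
    Form.contract (X + Y) α = Form.contract X α + Form.contract Y α :=
  Form.ext_value fun m => by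
    ext z
    simp only [Form.value_contract_apply, Form.value_add, add_apply,
      Multivector.value_add, add_mul, map_add]

theorem Form.smul_contract (c : ℝ) (X : Multivector E M) (α : Form E M) :
    Form.contract (c • X) α = c • Form.contract X α :=
  Form.ext_value fun m => by
    ext z
    simp only [Form.value_contract_apply, Form.value_smul, smul_apply,
      Multivector.value_smul, smul_mul_assoc, map_smul]

theorem Form.flip_contract (X : Multivector E M) (α : Form E M) :
    (Form.contract X α).flip = Form.contract X.flip α.flip :=
  Form.ext_value fun m => by
    ext z
    simp only [Form.value_contract_apply, Form.value_flip_apply, Multivector.value_flip, map_mul,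
      CliffordAlgebra.involute_involute]

theorem Form.loc_eq_pairingEquiv (α : Form E M) (x : M) (y : E) :
    α.loc x y = pairingEquiv fun r => (α r).inChart x y :=
  (pairingEquiv_compContinuousLinearMap (E := E) (F := E) _ _).symm

theorem Multivector.loc_eq_total (X : Multivector E M) (x : M) (y : E) :
    X.loc x y = total fun r => (X r).inChart x y := by
  refine (total_map (V := E) (W := E) _ rfl _).symm.trans ?_
  with_unfolding_all rfl

theorem Form.loc_add (α β : Form E M) (x : M) : (α + β).loc x = α.loc x + β.loc x := by
  funext y
  simp only [Form.loc, Form.value_add, ContinuousLinearMap.add_comp, Pi.add_apply]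

theorem Form.loc_sub (α β : Form E M) (x : M) : (α - β).loc x = α.loc x - β.loc x := by
  rw [eq_sub_iff_add_eq, ← Form.loc_add, sub_add_cancel]

theorem Form.loc_smul (c : ℝ) (α : Form E M) (x : M) : (c • α).loc x = c • α.loc x := by
  funext y
  simp only [Form.loc, Form.value_smul, ContinuousLinearMap.smul_comp, Pi.smul_apply]

theorem Multivector.loc_add (X Y : Multivector E M) (x : M) :
    (X + Y).loc x = X.loc x + Y.loc x := by
  funext y
  simp only [Multivector.loc, Multivector.value_add, map_add, Pi.add_apply]

theorem Multivector.loc_smul (c : ℝ) (X : Multivector E M) (x : M) :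
    (c • X).loc x = c • X.loc x := by
  funext y
  simp only [Multivector.loc, Multivector.value_smul, map_smul, Pi.smul_apply]

theorem Multivector.loc_flip (X : Multivector E M) (x : M) (y : E) :
    X.flip.loc x y = involute (X.loc x y) := by
  simp only [Multivector.loc, Multivector.value_flip, exteriorMap_apply, involute_map]

theorem Form.isSmooth_iff {α : Form E M} : α.IsSmooth ↔
    ∀ x, ContDiffOn ℝ (⊤ : ℕ∞) (α.loc x) (extChartAt 𝓘(ℝ, E) x).target := by
  simp only [funext (Form.loc_eq_pairingEquiv α _), contDiffOn_pairingEquiv_iff]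
  exact forall_comm

theorem Multivector.isSmooth_iff {X : Multivector E M} : X.IsSmooth ↔
    ∀ x, ContDiffOn ℝ (⊤ : ℕ∞) (X.loc x) (extChartAt 𝓘(ℝ, E) x).target := by
  rw [forall_congr' fun x => contDiffOn_iff_forall_dual]
  refine ⟨fun h x φ => ?_, fun h r x l => ?_⟩
  · simp only [loc_eq_total, total_apply, map_sum]
    refine ContDiffOn.sum fun r _ => ?_
    have : φ ∘ₗ (⋀[ℝ]^r E).subtype = exteriorPower.alternatingMapLinearEquiv
        (φ.compAlternatingMap (ExteriorAlgebra.ιMulti ℝ r)) := by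
      apply exteriorPower.linearMap_ext
      ext v
      simp
    exact (h r x _).congr fun y _ => LinearMap.congr_fun this _
  · refine (h x (exteriorPower.alternatingMapLinearEquiv l ∘ₗ LinearMap.proj r ∘ₗ
      total.symm.toLinearMap)).congr fun y _ => ?_
    simp only [loc_eq_total, LinearMap.comp_apply, LinearEquiv.coe_coe,
      LinearEquiv.symm_apply_apply, LinearMap.proj_apply]

theorem Form.IsSmooth.add {α β : Form E M} (hα : α.IsSmooth) (hβ : β.IsSmooth) :
    (α + β).IsSmooth :=
  Form.isSmooth_iff.2 fun x => by
    rw [Form.loc_add]; exact (Form.isSmooth_iff.1 hα x).add (Form.isSmooth_iff.1 hβ x)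

theorem Form.IsSmooth.smul {α : Form E M} (hα : α.IsSmooth) (c : ℝ) : (c • α).IsSmooth :=
  Form.isSmooth_iff.2 fun x => by
    rw [Form.loc_smul]; exact (Form.isSmooth_iff.1 hα x).const_smul c

theorem Multivector.IsSmooth.add {X Y : Multivector E M} (hX : X.IsSmooth) (hY : Y.IsSmooth) :
    (X + Y).IsSmooth :=
  Multivector.isSmooth_iff.2 fun x => by
    rw [Multivector.loc_add]
    exact (Multivector.isSmooth_iff.1 hX x).add (Multivector.isSmooth_iff.1 hY x)

theorem Multivector.IsSmooth.smul {X : Multivector E M} (hX : X.IsSmooth) (c : ℝ) :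
    (c • X).IsSmooth :=
  Multivector.isSmooth_iff.2 fun x => by
    rw [Multivector.loc_smul]; exact (Multivector.isSmooth_iff.1 hX x).const_smul c

theorem Multivector.IsSmooth.flip {X : Multivector E M} (hX : X.IsSmooth) : X.flip.IsSmooth :=
  Multivector.isSmooth_iff.2 fun x =>
    ((involute (Q := (0 : QuadraticForm ℝ E))).toLinearMap.toContinuousLinearMap.contDiff
      |>.comp_contDiffOn (Multivector.isSmooth_iff.1 hX x)).congr fun y _ => X.loc_flip x y

theorem Form.IsSmooth.differentiableAt_loc {α : Form E M} (hα : α.IsSmooth) {x : M} {y : E}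
    (hy : y ∈ (extChartAt 𝓘(ℝ, E) x).target) : DifferentiableAt ℝ (α.loc x) y :=
  ((Form.isSmooth_iff.1 hα x).differentiableOn (by simp)).differentiableAt
    ((isOpen_extChartAt_target x).mem_nhds hy)

theorem Multivector.IsSmooth.differentiableAt_loc {X : Multivector E M} (hX : X.IsSmooth) {x : M}
    {y : E} (hy : y ∈ (extChartAt 𝓘(ℝ, E) x).target) : DifferentiableAt ℝ (X.loc x) y :=
  ((Multivector.isSmooth_iff.1 hX x).differentiableOn (by simp)).differentiableAt
    ((isOpen_extChartAt_target x).mem_nhds hy)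

theorem Form.value_d {α : Form E M} (hα : α.IsSmooth) (m : M) :
    α.d.value m = exteriorDeriv (α.loc m) (extChartAt 𝓘(ℝ, E) m m)
      ∘L exteriorMap (chartDeriv m m) := by
  have hdiff := hα.differentiableAt_loc (mem_extChartAt_target (I := 𝓘(ℝ, E)) m)
  rw [funext (α.loc_eq_pairingEquiv m)] at hdiff ⊢
  rw [exteriorDeriv_pairingEquiv (differentiableAt_pairingEquiv_iff.1 hdiff),
    ← pairingEquiv_compContinuousLinearMap, Form.value]
  congr 1
  funext r
  cases r <;> rfl

section Transition

variable [IsManifold 𝓘(ℝ, E) (⊤ : ℕ∞) M]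

theorem exteriorMap_chartSymmDeriv_chartDeriv {x m : M} (hm : m ∈ (extChartAt 𝓘(ℝ, E) x).source)
    (z : ExteriorAlgebra ℝ E) :
    exteriorMap (chartSymmDeriv x (extChartAt 𝓘(ℝ, E) x m)) (exteriorMap (chartDeriv x m) z)
      = z := by
  rw [← ContinuousLinearMap.comp_apply, ← exteriorMap_comp, chartSymmDeriv_comp_chartDeriv hm,
    exteriorMap_id, ContinuousLinearMap.id_apply]

theorem exteriorMap_chartDeriv_chartSymmDeriv {x : M} {y : E}
    (hy : y ∈ (extChartAt 𝓘(ℝ, E) x).target) (z : ExteriorAlgebra ℝ E) :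
    exteriorMap (chartDeriv x ((extChartAt 𝓘(ℝ, E) x).symm y))
      (exteriorMap (chartSymmDeriv x y) z) = z := by
  rw [← ContinuousLinearMap.comp_apply, ← exteriorMap_comp, chartDeriv_comp_chartSymmDeriv hy,
    exteriorMap_id, ContinuousLinearMap.id_apply]

theorem Form.loc_contract (X : Multivector E M) (α : Form E M) {x : M} {y : E}
    (hy : y ∈ (extChartAt 𝓘(ℝ, E) x).target) :
    (Form.contract X α).loc x y = interior (X.loc x) (α.loc x) y := by
  have h := exteriorMap_chartSymmDeriv_chartDeriv ((extChartAt 𝓘(ℝ, E) x).map_target hy)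
  rw [(extChartAt 𝓘(ℝ, E) x).right_inv hy] at h
  ext z
  simp only [Form.loc, Multivector.loc, interior_apply, ContinuousLinearMap.comp_apply,
    Form.value_contract_apply, exteriorMap_mul, h]

theorem Form.ext_loc {α β : Form E M}
    (h : ∀ m, α.loc m (extChartAt 𝓘(ℝ, E) m m) = β.loc m (extChartAt 𝓘(ℝ, E) m m)) : α = β :=
  Form.ext_value fun m => by
    ext z
    simpa only [Form.loc, ContinuousLinearMap.comp_apply, extChartAt_to_inv,
      exteriorMap_chartSymmDeriv_chartDeriv (mem_extChartAt_source m)] using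
      DFunLike.congr_fun (h m) (exteriorMap (chartDeriv m m) z)

theorem Multivector.loc_transition (X : Multivector E M) {x x' : M} {y : E}
    (hy : y ∈ (extChartAt 𝓘(ℝ, E) x').target)
    (hx : (extChartAt 𝓘(ℝ, E) x').symm y ∈ (extChartAt 𝓘(ℝ, E) x).source) :
    X.loc x (transition x' x y) = exteriorMap (fderiv ℝ (transition x' x) y) (X.loc x' y) := by
  have h := exteriorMap_chartSymmDeriv_chartDeriv ((extChartAt 𝓘(ℝ, E) x').map_target hy)
  rw [(extChartAt 𝓘(ℝ, E) x').right_inv hy] at h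
  rw [fderiv_transition hy hx, exteriorMap_comp, ContinuousLinearMap.comp_apply, Multivector.loc,
    Multivector.loc, transition, Function.comp_apply, (extChartAt 𝓘(ℝ, E) x).left_inv hx, h]

theorem Form.pullback_transition (α : Form E M) {x x' : M} {y : E}
    (hy : y ∈ (extChartAt 𝓘(ℝ, E) x').target)
    (hx : (extChartAt 𝓘(ℝ, E) x').symm y ∈ (extChartAt 𝓘(ℝ, E) x).source) :
    pullback (transition x' x) (α.loc x) y = α.loc x' y := by
  ext z
  rw [pullback, fderiv_transition hy hx, exteriorMap_comp, Form.loc, transition,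
    Function.comp_apply, (extChartAt 𝓘(ℝ, E) x).left_inv hx]
  simp only [ContinuousLinearMap.comp_apply, exteriorMap_chartSymmDeriv_chartDeriv hx]
  rfl

theorem Form.loc_d {α : Form E M} (hα : α.IsSmooth) {x : M} {y : E}
    (hy : y ∈ (extChartAt 𝓘(ℝ, E) x).target) : α.d.loc x y = exteriorDeriv (α.loc x) y := by
  set m := (extChartAt 𝓘(ℝ, E) x).symm y with hm
  have hm_target : extChartAt 𝓘(ℝ, E) m m ∈ (extChartAt 𝓘(ℝ, E) m).target :=
    mem_extChartAt_target m
  have hm_symm : (extChartAt 𝓘(ℝ, E) m).symm (extChartAt 𝓘(ℝ, E) m m) = m := extChartAt_to_inv m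
  have hm_source : (extChartAt 𝓘(ℝ, E) m).symm (extChartAt 𝓘(ℝ, E) m m)
      ∈ (extChartAt 𝓘(ℝ, E) x).source := by
    rw [hm_symm]; exact (extChartAt 𝓘(ℝ, E) x).map_target hy
  have transition_m : transition m x (extChartAt 𝓘(ℝ, E) m m) = y := by
    rw [transition, Function.comp_apply, hm_symm, hm, (extChartAt 𝓘(ℝ, E) x).right_inv hy]
  have loc_m : α.loc m =ᶠ[nhds (extChartAt 𝓘(ℝ, E) m m)] pullback (transition m x) (α.loc x) :=
    (eventually_mem_overlap hm_target hm_source).mono fun y' hy' =>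
      (α.pullback_transition hy'.1 hy'.2).symm
  rw [Form.loc, Form.value_d hα, exteriorDeriv_congr loc_m,
    exteriorDeriv_pullback (by rw [transition_m]; exact hα.differentiableAt_loc hy)
      (contDiffAt_transition hm_target hm_source), pullback, transition_m,
    fderiv_transition hm_target hm_source, hm_symm, exteriorMap_comp]
  ext z
  simp only [ContinuousLinearMap.comp_apply]
  rw [exteriorMap_chartSymmDeriv_chartDeriv (mem_extChartAt_source m), hm,
    exteriorMap_chartDeriv_chartSymmDeriv hy]

theorem Form.IsSmooth.d {α : Form E M} (hα : α.IsSmooth) : α.d.IsSmooth :=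
  Form.isSmooth_iff.2 fun x =>
    (contDiffOn_exteriorDeriv (isOpen_extChartAt_target x) (Form.isSmooth_iff.1 hα x)).congr
      fun _ hy => Form.loc_d hα hy

theorem Form.IsSmooth.contract {α : Form E M} (hα : α.IsSmooth) {X : Multivector E M}
    (hX : X.IsSmooth) : (Form.contract X α).IsSmooth :=
  Form.isSmooth_iff.2 fun x => ((Form.isSmooth_iff.1 hα x).clm_comp
    (wedge.contDiff.comp_contDiffOn (Multivector.isSmooth_iff.1 hX x))).congr
      fun _ hy => Form.loc_contract X α hy

theorem Form.d_add {α β : Form E M} (hα : α.IsSmooth) (hβ : β.IsSmooth) :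
    (α + β).d = α.d + β.d :=
  Form.ext_loc fun m => by
    have hm := mem_extChartAt_target (I := 𝓘(ℝ, E)) m
    rw [Form.loc_add, Form.loc_d (hα.add hβ) hm, Pi.add_apply, Form.loc_d hα hm, Form.loc_d hβ hm,
      Form.loc_add, exteriorDeriv_add (hα.differentiableAt_loc hm) (hβ.differentiableAt_loc hm)]

theorem Form.d_smul {α : Form E M} (hα : α.IsSmooth) (c : ℝ) : (c • α).d = c • α.d :=
  Form.ext_loc fun m => by
    have hm := mem_extChartAt_target (I := 𝓘(ℝ, E)) m
    rw [Form.loc_smul, Form.loc_d (hα.smul c) hm, Pi.smul_apply, Form.loc_d hα hm,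
      Form.loc_smul, exteriorDeriv_const_smul]

theorem Form.d_d {α : Form E M} (hα : α.IsSmooth) : α.d.d = 0 :=
  Form.ext_loc fun m => by
    have hm := mem_extChartAt_target (I := 𝓘(ℝ, E)) m
    have loc_zero : (0 : Form E M).loc m (extChartAt 𝓘(ℝ, E) m m) = 0 := by
      simpa using congrFun (Form.loc_smul 0 (0 : Form E M) m) (extChartAt 𝓘(ℝ, E) m m)
    have loc_d : α.d.loc m =ᶠ[nhds (extChartAt 𝓘(ℝ, E) m m)] exteriorDeriv (α.loc m) :=
      ((isOpen_extChartAt_target m).eventually_mem hm).mono fun _ hy => Form.loc_d hα hy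
    rw [Form.loc_d hα.d hm, exteriorDeriv_congr loc_d, loc_zero, exteriorDeriv_exteriorDeriv
      (isOpen_extChartAt_target m) (Form.isSmooth_iff.1 hα m) hm]

end Transition

end LocalExpressions

/-! ### The Schouten bracket -/

section SchoutenBracket

open CliffordAlgebra (involute)

variable {E : Type u} [NormedAddCommGroup E] [NormedSpace ℝ E] [FiniteDimensional ℝ E]
  {M : Type v} [TopologicalSpace M] [ChartedSpace E M]

theorem Multivector.involute_value {X : Multivector E M} {r : ℤ} (hX : X.flip = sgn r • X)
    (m : M) : involute (X.value m) = sgn r • X.value m := by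
  rw [← Multivector.value_flip, hX, Multivector.value_smul]

theorem Multivector.involute_loc {X : Multivector E M} {r : ℤ} (hX : X.flip = sgn r • X) (x : M)
    (y : E) : involute (X.loc x y) = sgn r • X.loc x y := by
  rw [← Multivector.loc_flip, hX, Multivector.loc_smul, Pi.smul_apply]

theorem Form.contract_comm_of_parity {r s : ℤ} {X Y : Multivector E M} (hr : X.flip = sgn r • X)
    (hs : Y.flip = sgn s • Y) (α : Form E M) :
    Form.contract X (Form.contract Y α) = sgn (r * s) • Form.contract Y (Form.contract X α) :=
  Form.ext_value fun m => by
    ext z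
    rw [Form.value_smul, smul_apply]
    simp only [Form.value_contract_apply, ← mul_assoc]
    rw [mul_comm_of_parity (Multivector.involute_value hs m) (Multivector.involute_value hr m),
      smul_mul_assoc, map_smul, mul_comm s r]

theorem Form.lieDeriv_of_parity {r : ℤ} {X : Multivector E M} (hr : X.flip = sgn r • X)
    (α : Form E M) :
    Form.lieDeriv X α = (Form.contract X α).d - sgn r • Form.contract X α.d := by
  rw [← Form.smul_contract, ← hr]
  rfl

/-- The Schouten bracket of two multivector fields of parities `r` and `s`, computed at `m` in the
preferred chart at `m`. -/
def schoutenBracket (r s : ℤ) (X Y : Multivector E M) : Multivector E M := fun k m =>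
  ((total (V := E)).symm (exteriorMap (chartSymmDeriv m (extChartAt 𝓘(ℝ, E) m m))
    (localBracket r s (X.loc m) (Y.loc m) (extChartAt 𝓘(ℝ, E) m m))) k : ⋀[ℝ]^k E)

theorem value_schoutenBracket (r s : ℤ) (X Y : Multivector E M) (m : M) :
    (schoutenBracket r s X Y).value m =
      exteriorMap (chartSymmDeriv m (extChartAt 𝓘(ℝ, E) m m))
        (localBracket r s (X.loc m) (Y.loc m) (extChartAt 𝓘(ℝ, E) m m)) :=
  (total (V := E)).apply_symm_apply _

theorem flip_schoutenBracket {r s : ℤ} {X Y : Multivector E M} (hX : X.IsSmooth)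
    (hY : Y.IsSmooth) (hr : X.flip = sgn r • X) (hs : Y.flip = sgn s • Y) :
    (schoutenBracket r s X Y).flip = sgn (r + s - 1) • schoutenBracket r s X Y :=
  Multivector.ext_value fun m => by
    have hm := mem_extChartAt_target (I := 𝓘(ℝ, E)) m
    rw [Multivector.value_flip, Multivector.value_smul, value_schoutenBracket, exteriorMap_apply,
      involute_map, involute_localBracket (hX.differentiableAt_loc hm) (hY.differentiableAt_loc hm)
        (.of_forall (Multivector.involute_loc hr m)) (.of_forall (Multivector.involute_loc hs m)),
      map_smul]

variable [IsManifold 𝓘(ℝ, E) (⊤ : ℕ∞) M]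

theorem Form.loc_lieDeriv {r : ℤ} {X : Multivector E M} (hX : X.IsSmooth)
    (hr : X.flip = sgn r • X) {α : Form E M} (hα : α.IsSmooth) {x : M} {y : E}
    (hy : y ∈ (extChartAt 𝓘(ℝ, E) x).target) :
    (Form.lieDeriv X α).loc x y = lieAlong r (X.loc x) (α.loc x) y := by
  have loc_contract : (Form.contract X α).loc x =ᶠ[nhds y] interior (X.loc x) (α.loc x) :=
    ((isOpen_extChartAt_target x).eventually_mem hy).mono fun _ hy => Form.loc_contract X α hy
  rw [Form.lieDeriv_of_parity hr, Form.loc_sub, Form.loc_smul, Pi.sub_apply, Pi.smul_apply,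
    Form.loc_d (hα.contract hX) hy, exteriorDeriv_congr loc_contract, Form.loc_contract X _ hy,
    interior, Form.loc_d hα hy]
  rfl

theorem loc_schoutenBracket {r s : ℤ} {X Y : Multivector E M} (hX : X.IsSmooth) (hY : Y.IsSmooth)
    (hr : X.flip = sgn r • X) (hs : Y.flip = sgn s • Y) {x : M} {y : E}
    (hy : y ∈ (extChartAt 𝓘(ℝ, E) x).target) :
    (schoutenBracket r s X Y).loc x y = localBracket r s (X.loc x) (Y.loc x) y := by
  set m := (extChartAt 𝓘(ℝ, E) x).symm y with hm
  have hm_target := mem_extChartAt_target (I := 𝓘(ℝ, E)) m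
  have hm_symm : (extChartAt 𝓘(ℝ, E) m).symm (extChartAt 𝓘(ℝ, E) m m) = m := extChartAt_to_inv m
  have hm_source : (extChartAt 𝓘(ℝ, E) m).symm (extChartAt 𝓘(ℝ, E) m m)
      ∈ (extChartAt 𝓘(ℝ, E) x).source := by
    rw [hm_symm]; exact (extChartAt 𝓘(ℝ, E) x).map_target hy
  have transition_m : transition m x (extChartAt 𝓘(ℝ, E) m m) = y := by
    rw [transition, Function.comp_apply, hm_symm, hm, (extChartAt 𝓘(ℝ, E) x).right_inv hy]
  have related (Z : Multivector E M) : ∀ᶠ y' in nhds (extChartAt 𝓘(ℝ, E) m m),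
      Z.loc x (transition m x y') = exteriorMap (fderiv ℝ (transition m x) y') (Z.loc m y') :=
    (eventually_mem_overlap hm_target hm_source).mono fun y' hy' => Z.loc_transition hy'.1 hy'.2
  have key := localBracket_map (contDiffAt_transition hm_target hm_source) (related X) (related Y)
    (hX.differentiableAt_loc hm_target) (hY.differentiableAt_loc hm_target)
    (hX.differentiableAt_loc (by rwa [transition_m]))
    (hY.differentiableAt_loc (by rwa [transition_m]))
    (.of_forall (Multivector.involute_loc hr m)) (Multivector.involute_loc hs m _)
    (.of_forall (Multivector.involute_loc hr x)) (Multivector.involute_loc hs x _)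
  rw [transition_m, fderiv_transition hm_target hm_source, hm_symm, exteriorMap_comp,
    ContinuousLinearMap.comp_apply, ← value_schoutenBracket] at key
  exact key.symm

theorem isSmooth_schoutenBracket {r s : ℤ} {X Y : Multivector E M} (hX : X.IsSmooth)
    (hY : Y.IsSmooth) (hr : X.flip = sgn r • X) (hs : Y.flip = sgn s • Y) :
    (schoutenBracket r s X Y).IsSmooth :=
  Multivector.isSmooth_iff.2 fun x =>
    (contDiffOn_localBracket r s (isOpen_extChartAt_target x) (Multivector.isSmooth_iff.1 hX x)
      (Multivector.isSmooth_iff.1 hY x)).congr fun _ hy => loc_schoutenBracket hX hY hr hs hy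

/-- With `[a, b] = a b - (-1)^{|a||b|} b a`, this says `i_{[X, Y]} = [[d, i_X], i_Y]`. -/
theorem Form.contract_schoutenBracket {r s : ℤ} {X Y : Multivector E M} (hX : X.IsSmooth)
    (hY : Y.IsSmooth) (hr : X.flip = sgn r • X) (hs : Y.flip = sgn s • Y) {α : Form E M}
    (hα : α.IsSmooth) :
    Form.contract (schoutenBracket r s X Y) α = Form.lieDeriv X (Form.contract Y α)
      - sgn ((r - 1) * s) • Form.contract Y (Form.lieDeriv X α) :=
  Form.ext_loc fun m => by
    have hm := mem_extChartAt_target (I := 𝓘(ℝ, E)) m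
    have loc_contract : (Form.contract Y α).loc m =ᶠ[nhds (extChartAt 𝓘(ℝ, E) m m)]
        interior (Y.loc m) (α.loc m) :=
      ((isOpen_extChartAt_target m).eventually_mem hm).mono fun _ hy => Form.loc_contract Y α hy
    rw [Form.loc_contract _ α hm, interior, loc_schoutenBracket hX hY hr hs hm, Form.loc_sub,
      Form.loc_smul, Pi.sub_apply, Pi.smul_apply, Form.loc_lieDeriv hX hr (hα.contract hY) hm,
      lieAlong_congr r _ loc_contract, Form.loc_contract Y _ hm, interior,
      Form.loc_lieDeriv hX hr hα hm]
    exact (lieAlong_interior_sub (hα.differentiableAt_loc hm) (hX.differentiableAt_loc hm)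
      (hY.differentiableAt_loc hm) (.of_forall (Multivector.involute_loc hr m))
      (Multivector.involute_loc hs m _)).symm

end SchoutenBracket

/-! ### Lie derivatives along smooth multivector fields -/

section LieDerivative

variable {E : Type u} [NormedAddCommGroup E] [NormedSpace ℝ E]
  {M : Type v} [TopologicalSpace M] [ChartedSpace E M]

theorem Multivector.flip_add (X Y : Multivector E M) : (X + Y).flip = X.flip + Y.flip :=
  funext fun _ => smul_add _ _ _

theorem Multivector.flip_smul (c : ℝ) (X : Multivector E M) : (c • X).flip = c • X.flip :=
  funext fun r => smul_comm ((-1 : ℝ) ^ r) c (X r)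

theorem Multivector.flip_sub (X Y : Multivector E M) : (X - Y).flip = X.flip - Y.flip :=
  funext fun _ => smul_sub _ _ _

theorem Form.flip_smul (c : ℝ) (α : Form E M) : (c • α).flip = c • α.flip :=
  funext fun r => smul_comm ((-1 : ℝ) ^ r) c (α r)

theorem Form.neg_eq_smul (α : Form E M) : -α = (-1 : ℝ) • α := (neg_one_smul ℝ α).symm

theorem Form.IsSmooth.neg [FiniteDimensional ℝ E] {α : Form E M} (hα : α.IsSmooth) :
    (-α).IsSmooth := by
  rw [Form.neg_eq_smul]
  exact hα.smul _

variable [FiniteDimensional ℝ E]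

theorem Form.IsSmooth.sub {α β : Form E M} (hα : α.IsSmooth) (hβ : β.IsSmooth) :
    (α - β).IsSmooth := by
  rw [sub_eq_add_neg]
  exact hα.add hβ.neg

theorem Form.contract_neg (X : Multivector E M) (α : Form E M) :
    Form.contract X (-α) = -Form.contract X α := by
  rw [Form.neg_eq_smul, Form.contract_smul, ← Form.neg_eq_smul]

theorem Form.contract_zero (X : Multivector E M) : Form.contract X (0 : Form E M) = 0 := by
  simpa using Form.contract_add X 0 (0 : Form E M)

theorem Form.sub_contract (X Y : Multivector E M) (α : Form E M) :
    Form.contract (X - Y) α = Form.contract X α - Form.contract Y α := by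
  rw [eq_sub_iff_add_eq, ← Form.add_contract, sub_add_cancel]

variable [IsManifold 𝓘(ℝ, E) (⊤ : ℕ∞) M]

theorem Form.IsSmooth.lieDeriv {X : Multivector E M} (hX : X.IsSmooth) {α : Form E M}
    (hα : α.IsSmooth) : (Form.lieDeriv X α).IsSmooth :=
  (hα.contract hX).d.sub (hα.d.contract hX.flip)

theorem Form.d_neg {α : Form E M} (hα : α.IsSmooth) : (-α).d = -α.d := by
  rw [Form.neg_eq_smul, Form.d_smul hα, ← Form.neg_eq_smul]

theorem Form.d_sub {α β : Form E M} (hα : α.IsSmooth) (hβ : β.IsSmooth) :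
    (α - β).d = α.d - β.d := by
  rw [sub_eq_add_neg, Form.d_add hα hβ.neg, Form.d_neg hβ, sub_eq_add_neg]

theorem Form.lieDeriv_add {X : Multivector E M} (hX : X.IsSmooth) {α β : Form E M}
    (hα : α.IsSmooth) (hβ : β.IsSmooth) :
    Form.lieDeriv X (α + β) = Form.lieDeriv X α + Form.lieDeriv X β := by
  simp only [Form.lieDeriv, Form.contract_add, Form.d_add (hα.contract hX) (hβ.contract hX),
    Form.d_add hα hβ]
  abel

theorem Form.lieDeriv_smul {X : Multivector E M} (hX : X.IsSmooth) {α : Form E M}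
    (hα : α.IsSmooth) (c : ℝ) : Form.lieDeriv X (c • α) = c • Form.lieDeriv X α := by
  simp only [Form.lieDeriv, Form.contract_smul, Form.d_smul (hα.contract hX), Form.d_smul hα]
  module

theorem Form.lieDeriv_neg {X : Multivector E M} (hX : X.IsSmooth) {α : Form E M}
    (hα : α.IsSmooth) : Form.lieDeriv X (-α) = -Form.lieDeriv X α := by
  rw [Form.neg_eq_smul, Form.lieDeriv_smul hX hα, ← Form.neg_eq_smul]

theorem Form.lieDeriv_sub {X : Multivector E M} (hX : X.IsSmooth) {α β : Form E M}
    (hα : α.IsSmooth) (hβ : β.IsSmooth) :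
    Form.lieDeriv X (α - β) = Form.lieDeriv X α - Form.lieDeriv X β := by
  rw [sub_eq_add_neg, Form.lieDeriv_add hX hα hβ.neg, Form.lieDeriv_neg hX hβ, sub_eq_add_neg]

theorem Form.add_lieDeriv {X Y : Multivector E M} (hX : X.IsSmooth) (hY : Y.IsSmooth)
    {α : Form E M} (hα : α.IsSmooth) :
    Form.lieDeriv (X + Y) α = Form.lieDeriv X α + Form.lieDeriv Y α := by
  change (Form.contract (X + Y) α).d - Form.contract (X + Y).flip α.d = _
  rw [Multivector.flip_add, Form.add_contract, Form.add_contract,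
    Form.d_add (hα.contract hX) (hα.contract hY), add_sub_add_comm]
  rfl

theorem Form.smul_lieDeriv {X : Multivector E M} (hX : X.IsSmooth) {α : Form E M}
    (hα : α.IsSmooth) (c : ℝ) : Form.lieDeriv (c • X) α = c • Form.lieDeriv X α := by
  change (Form.contract (c • X) α).d - Form.contract (c • X).flip α.d = _
  rw [Multivector.flip_smul, Form.smul_contract, Form.smul_contract, Form.d_smul (hα.contract hX)]
  exact (smul_sub c _ _).symm

theorem Form.d_lieDeriv {r : ℤ} {X : Multivector E M} (hX : X.IsSmooth) (hr : X.flip = sgn r • X)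
    {α : Form E M} (hα : α.IsSmooth) :
    (Form.lieDeriv X α).d = -sgn r • Form.lieDeriv X α.d := by
  have contract_d := hα.d.contract hX
  rw [Form.lieDeriv_of_parity hr, Form.lieDeriv_of_parity hr, Form.d_d hα, Form.contract_zero,
    smul_zero, sub_zero, Form.d_sub (hα.contract hX).d (contract_d.smul _),
    Form.d_d (hα.contract hX), Form.d_smul contract_d, zero_sub]
  exact (neg_smul _ _).symm

/-- With `[a, b] = a b - (-1)^{|a||b|} b a`, this says `L_{[X, Y]} = -(-1)^{|X|} [L_X, L_Y]`. -/
theorem Form.lieDeriv_schoutenBracket {r s : ℤ} {X Y : Multivector E M} (hX : X.IsSmooth)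
    (hY : Y.IsSmooth) (hr : X.flip = sgn r • X) (hs : Y.flip = sgn s • Y) {α : Form E M}
    (hα : α.IsSmooth) :
    Form.lieDeriv (schoutenBracket r s X Y) α = -sgn r • Form.lieDeriv X (Form.lieDeriv Y α)
      - sgn ((r - 1) * s) • Form.lieDeriv Y (Form.lieDeriv X α) := by
  have lieDeriv_smooth := hα.lieDeriv hX
  have lieDeriv_d : Form.lieDeriv X α.d = -sgn r • (Form.lieDeriv X α).d := by
    rw [Form.d_lieDeriv hX hr hα, smul_smul, neg_mul_neg, sgn_mul_self, one_smul]
  rw [Form.lieDeriv_of_parity (flip_schoutenBracket hX hY hr hs),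
    Form.contract_schoutenBracket hX hY hr hs hα, Form.contract_schoutenBracket hX hY hr hs hα.d,
    Form.d_sub ((hα.contract hY).lieDeriv hX) ((lieDeriv_smooth.contract hY).smul _),
    Form.d_lieDeriv hX hr (hα.contract hY), Form.d_smul (lieDeriv_smooth.contract hY), lieDeriv_d,
    Form.contract_smul, Form.lieDeriv_of_parity hs α,
    Form.lieDeriv_of_parity hs (Form.lieDeriv X α),
    Form.lieDeriv_sub hX (hα.contract hY).d ((hα.d.contract hY).smul _),
    Form.lieDeriv_smul hX (hα.d.contract hY), sgn_sub, sgn_add, sgn_one]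
  have := sgn_mul_self r
  match_scalars <;> grind

end LieDerivative

/-! ### Hamiltonian pairs and their bracket -/

section Hamiltonian

variable {E : Type u} [NormedAddCommGroup E] [NormedSpace ℝ E]
  {M : Type v} [TopologicalSpace M] [ChartedSpace E M] {ω f g : Form E M} {k r s : ℤ}
  {X Y X' Y' : Multivector E M}

/-- `X` and `Y` solve the two fundamental equations for `f`, and have the parities they would have
if `f` were homogeneous of symmetric degree `r`. -/
structure HamiltonianPair (ω f : Form E M) (r : ℤ) (X Y : Multivector E M) : Prop where
  smooth_fst : X.IsSmooth
  smooth_snd : Y.IsSmooth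
  flip_fst : X.flip = sgn r • X
  flip_snd : Y.flip = sgn (r + 1) • Y
  contract_fst : Form.contract X ω = -f.d
  contract_snd : Form.contract Y ω = -f

/-- The 2-bracket of two forms of parities `r` and `s` with associated fields `X` and `Y`. -/
def homotopyBracket (r s : ℤ) (X Y : Multivector E M) (f g : Form E M) : Form E M :=
  sgn r • Form.lieDeriv X g + (sgn (r * s) * sgn s) • Form.lieDeriv Y f

theorem HamiltonianPair.eq_neg_contract (h : HamiltonianPair ω f r X Y) :
    f = -Form.contract Y ω := by
  rw [h.contract_snd, neg_neg]

variable [FiniteDimensional ℝ E]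

theorem Form.contract_flip_eq_zero (hk : ω.flip = sgn k • ω) {T : Multivector E M}
    (hT : Form.contract T ω = 0) : Form.contract T.flip ω = 0 := by
  have h := Form.flip_contract T ω
  rw [hT, hk, Form.contract_smul] at h
  have flip_zero : (0 : Form E M).flip = 0 := funext fun _ => smul_zero _
  rw [flip_zero] at h
  exact (smul_eq_zero.1 h.symm).resolve_left (left_ne_zero_of_mul_eq_one (sgn_mul_self k))

/-- Split the other factor into its even part, which commutes with `T`, and its odd part, which does
so up to the parity operator. -/
theorem Form.contract_contract_eq_zero (hk : ω.flip = sgn k • ω) {T : Multivector E M}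
    (hT : Form.contract T ω = 0) (Y : Multivector E M) :
    Form.contract T (Form.contract Y ω) = 0 :=
  Form.ext_value fun m => by
    have value_mul {S : Multivector E M} (hS : Form.contract S ω = 0) (w : ExteriorAlgebra ℝ E) :
        ω.value m (S.value m * w) = 0 := by
      rw [← Form.value_contract_apply, hS, Form.value_zero, zero_apply]
    ext z
    have key := congrArg (ω.value m <| · * z)
      (two_smul_mul (R := ℝ) (Y.value m) (T.value m))
    simp only [smul_mul_assoc, add_mul, map_smul, map_add, mul_assoc, ← Multivector.value_flip,
      value_mul hT, value_mul (Form.contract_flip_eq_zero hk hT), add_zero] at key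
    rw [Form.value_contract_apply, Form.value_contract_apply, Form.value_zero, zero_apply]
    exact (smul_eq_zero.1 key).resolve_left two_ne_zero

/-- The Lie derivative of a Hamiltonian form along `X` only depends on `i_X ω`, since `f` and `df`
are contractions of `ω`. -/
theorem Form.lieDeriv_eq_of_contract_eq (hk : ω.flip = sgn k • ω) {X X' Y Z : Multivector E M}
    {f : Form E M} (hX : Form.contract X ω = Form.contract X' ω) (hY : Form.contract Y ω = -f.d)
    (hZ : Form.contract Z ω = -f) : Form.lieDeriv X f = Form.lieDeriv X' f := by
  have hT : Form.contract (X - X') ω = 0 := by rw [Form.sub_contract, hX, sub_self]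
  have contract_f : Form.contract (X - X') f = 0 := by
    rw [← neg_eq_zero, ← Form.contract_neg, ← hZ, Form.contract_contract_eq_zero hk hT]
  have contract_d : Form.contract (X - X').flip f.d = 0 := by
    rw [← neg_eq_zero, ← Form.contract_neg, ← hY,
      Form.contract_contract_eq_zero hk (Form.contract_flip_eq_zero hk hT)]
  rw [Form.sub_contract, sub_eq_zero] at contract_f
  rw [Multivector.flip_sub, Form.sub_contract, sub_eq_zero] at contract_d
  exact congrArg₂ (fun α β => α.d - β) contract_f contract_d

theorem HamiltonianPair.flip_eq (h : HamiltonianPair ω f r X Y) (hk : ω.flip = sgn k • ω) :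
    f.flip = sgn (k - r - 1) • f := by
  rw [h.eq_neg_contract, Form.neg_eq_smul, Form.flip_smul, Form.flip_contract, hk, h.flip_snd,
    Form.smul_contract, Form.contract_smul, sub_sub, sgn_sub k]
  module

variable [IsManifold 𝓘(ℝ, E) (⊤ : ℕ∞) M]

theorem Form.lieDeriv_eq_zero_of_contract_eq (hd : ω.d = 0) (hf : f.IsSmooth)
    (hX : Form.contract X ω = -f.d) : Form.lieDeriv X ω = 0 := by
  change (Form.contract X ω).d - Form.contract X.flip ω.d = 0
  rw [hX, hd, Form.contract_zero, sub_zero, Form.d_neg hf.d, Form.d_d hf, neg_zero]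

namespace HamiltonianPair

theorem isSmooth (h : HamiltonianPair ω f r X Y) (hω : ω.IsSmooth) : f.IsSmooth := by
  rw [h.eq_neg_contract]
  exact (hω.contract h.smooth_snd).neg

theorem contract_schoutenBracket_snd (hf : HamiltonianPair ω f r X X')
    (hg : HamiltonianPair ω g s Y Y') (hω : ω.IsSmooth) (hd : ω.d = 0) :
    Form.contract (schoutenBracket r (s + 1) X Y') ω = -Form.lieDeriv X g := by
  rw [Form.contract_schoutenBracket hf.smooth_fst hg.smooth_snd hf.flip_fst hg.flip_snd hω,
    Form.lieDeriv_eq_zero_of_contract_eq hd (hf.isSmooth hω) hf.contract_fst, Form.contract_zero,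
    hg.contract_snd, smul_zero, sub_zero, Form.lieDeriv_neg hf.smooth_fst (hg.isSmooth hω)]

theorem contract_schoutenBracket_fst (hf : HamiltonianPair ω f r X X')
    (hg : HamiltonianPair ω g s Y Y') (hω : ω.IsSmooth) (hd : ω.d = 0) :
    Form.contract (schoutenBracket r s X Y) ω = sgn r • (Form.lieDeriv X g).d := by
  rw [Form.contract_schoutenBracket hf.smooth_fst hg.smooth_fst hf.flip_fst hg.flip_fst hω,
    Form.lieDeriv_eq_zero_of_contract_eq hd (hf.isSmooth hω) hf.contract_fst, Form.contract_zero,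
    hg.contract_fst, smul_zero, sub_zero, Form.lieDeriv_neg hf.smooth_fst (hg.isSmooth hω).d,
    Form.d_lieDeriv hf.smooth_fst hf.flip_fst (hg.isSmooth hω), smul_smul, mul_neg, sgn_mul_self,
    Form.neg_eq_smul]

theorem d_lieDeriv (hf : HamiltonianPair ω f r X X') (hg : HamiltonianPair ω g s Y Y')
    (hω : ω.IsSmooth) :
    (Form.lieDeriv X g).d = sgn r • (Form.contract X (Form.contract Y ω)).d := by
  have contract_d : (Form.contract X g.d).IsSmooth := (hg.isSmooth hω).d.contract hf.smooth_fst
  rw [Form.lieDeriv_of_parity hf.flip_fst, Form.d_sub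
    ((hg.isSmooth hω).contract hf.smooth_fst).d (contract_d.smul _),
    Form.d_d ((hg.isSmooth hω).contract hf.smooth_fst), Form.d_smul contract_d, zero_sub,
    hg.contract_fst, Form.contract_neg, Form.d_neg contract_d]
  exact (smul_neg _ _).symm

theorem contract_schoutenBracket_eq_d (hf : HamiltonianPair ω f r X X')
    (hg : HamiltonianPair ω g s Y Y') (hω : ω.IsSmooth) (hd : ω.d = 0) :
    Form.contract (schoutenBracket r s X Y) ω = (Form.contract X (Form.contract Y ω)).d := by
  rw [contract_schoutenBracket_fst hf hg hω hd, hf.d_lieDeriv hg hω, smul_smul, sgn_mul_self]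
  exact one_smul ℝ _

theorem d_homotopyBracket (hf : HamiltonianPair ω f r X X') (hg : HamiltonianPair ω g s Y Y')
    (hω : ω.IsSmooth) (hd : ω.d = 0) :
    (homotopyBracket r s X Y f g).d = (2 : ℝ) • Form.contract (schoutenBracket r s X Y) ω := by
  have swap : (Form.contract Y (Form.contract X ω)).d
      = sgn (r * s) • (Form.contract X (Form.contract Y ω)).d := by
    rw [Form.contract_comm_of_parity hg.flip_fst hf.flip_fst,
      Form.d_smul ((hω.contract hg.smooth_fst).contract hf.smooth_fst), mul_comm]
  have lie_f := (hf.isSmooth hω).lieDeriv hg.smooth_fst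
  have lie_g := (hg.isSmooth hω).lieDeriv hf.smooth_fst
  rw [homotopyBracket, Form.d_add (lie_g.smul _) (lie_f.smul _), Form.d_smul lie_g,
    Form.d_smul lie_f, contract_schoutenBracket_fst hf hg hω hd, hg.d_lieDeriv hf hω, swap,
    hf.d_lieDeriv hg hω]
  have := sgn_mul_self r
  have := sgn_mul_self s
  have := sgn_mul_self (r * s)
  match_scalars
  grind

theorem bracket (hf : HamiltonianPair ω f r X X') (hg : HamiltonianPair ω g s Y Y')
    (hω : ω.IsSmooth) (hd : ω.d = 0) :
    HamiltonianPair ω (homotopyBracket r s X Y f g) (r + s - 1)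
      ((-2 : ℝ) • schoutenBracket r s X Y)
      (sgn r • schoutenBracket r (s + 1) X Y'
        + (sgn (r * s) * sgn s) • schoutenBracket s (r + 1) Y X') where
  smooth_fst :=
    (isSmooth_schoutenBracket hf.smooth_fst hg.smooth_fst hf.flip_fst hg.flip_fst).smul _
  smooth_snd :=
    ((isSmooth_schoutenBracket hf.smooth_fst hg.smooth_snd hf.flip_fst hg.flip_snd).smul _).add
      ((isSmooth_schoutenBracket hg.smooth_fst hf.smooth_snd hg.flip_fst hf.flip_snd).smul _)
  flip_fst := by
    rw [Multivector.flip_smul,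
      flip_schoutenBracket hf.smooth_fst hg.smooth_fst hf.flip_fst hg.flip_fst]
    exact smul_comm _ _ _
  flip_snd := by
    rw [Multivector.flip_add, Multivector.flip_smul, Multivector.flip_smul,
      flip_schoutenBracket hf.smooth_fst hg.smooth_snd hf.flip_fst hg.flip_snd,
      flip_schoutenBracket hg.smooth_fst hf.smooth_snd hg.flip_fst hf.flip_snd,
      show r + (s + 1) - 1 = r + s - 1 + 1 by ring, show s + (r + 1) - 1 = r + s - 1 + 1 by ring]
    module
  contract_fst := by
    rw [Form.smul_contract, d_homotopyBracket hf hg hω hd]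
    exact neg_smul (2 : ℝ) (Form.contract (schoutenBracket r s X Y) ω)
  contract_snd := by
    rw [Form.add_contract, Form.smul_contract, Form.smul_contract,
      contract_schoutenBracket_snd hf hg hω hd, contract_schoutenBracket_snd hg hf hω hd,
      homotopyBracket]
    module

theorem lieDeriv_bracket {h : Form E M} {t : ℤ} {Z Z' D : Multivector E M}
    (hf : HamiltonianPair ω f r X X') (hg : HamiltonianPair ω g s Y Y')
    (hh : HamiltonianPair ω h t Z Z') (hω : ω.IsSmooth) (hd : ω.d = 0) (hk : ω.flip = sgn k • ω)
    (hD : Form.contract D ω = -(homotopyBracket r s X Y f g).d) :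
    Form.lieDeriv D h = (2 * sgn r) • Form.lieDeriv X (Form.lieDeriv Y h)
      + (2 * (sgn (r * s) * sgn s)) • Form.lieDeriv Y (Form.lieDeriv X h) := by
  have bracket_smooth :=
    isSmooth_schoutenBracket hf.smooth_fst hg.smooth_fst hf.flip_fst hg.flip_fst
  rw [Form.lieDeriv_eq_of_contract_eq hk (hD.trans (hf.bracket hg hω hd).contract_fst.symm)
      hh.contract_fst hh.contract_snd, Form.smul_lieDeriv bracket_smooth (hh.isSmooth hω),
    Form.lieDeriv_schoutenBracket hf.smooth_fst hg.smooth_fst hf.flip_fst hg.flip_fst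
      (hh.isSmooth hω), sub_mul, one_mul, sgn_sub]
  module

theorem lieDeriv_homotopyBracket {Z : Multivector E M} (hZ : Z.IsSmooth)
    (hf : HamiltonianPair ω f r X X') (hg : HamiltonianPair ω g s Y Y') (hω : ω.IsSmooth) :
    Form.lieDeriv Z (homotopyBracket r s X Y f g)
      = sgn r • Form.lieDeriv Z (Form.lieDeriv X g)
        + (sgn (r * s) * sgn s) • Form.lieDeriv Z (Form.lieDeriv Y f) := by
  have lie_f := (hf.isSmooth hω).lieDeriv hg.smooth_fst
  have lie_g := (hg.isSmooth hω).lieDeriv hf.smooth_fst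
  rw [homotopyBracket, Form.lieDeriv_add hZ (lie_g.smul _) (lie_f.smul _),
    Form.lieDeriv_smul hZ lie_g, Form.lieDeriv_smul hZ lie_f]

/-- The same six terms `L_i L_j f_k` arise from the `L_{D(f_i, f_j)} f_k` and from the
`L_k D(f_i, f_j)`, with coefficients `±2` from the former and half of that, of opposite sign, from
the latter. -/
theorem jacobi {r : Fin 3 → ℤ} {X Y : Fin 3 → Multivector E M} {f : Fin 3 → Form E M}
    (h : ∀ i, HamiltonianPair ω (f i) (r i) (X i) (Y i)) (hω : ω.IsSmooth) (hd : ω.d = 0)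
    (hk : ω.flip = sgn k • ω) {D : Fin 3 → Fin 3 → Multivector E M}
    (hD : ∀ i j, Form.contract (D i j) ω
      = -(homotopyBracket (r i) (r j) (X i) (X j) (f i) (f j)).d) :
    homotopyBracket (r 0 + r 1 - 1) (r 2) (D 0 1) (X 2)
        (homotopyBracket (r 0) (r 1) (X 0) (X 1) (f 0) (f 1)) (f 2)
      + sgn (r 2 * r 1) • homotopyBracket (r 0 + r 2 - 1) (r 1) (D 0 2) (X 1)
        (homotopyBracket (r 0) (r 2) (X 0) (X 2) (f 0) (f 2)) (f 1)
      + (sgn (r 1 * r 0) * sgn (r 2 * r 0)) • homotopyBracket (r 1 + r 2 - 1) (r 0) (D 1 2) (X 0)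
        (homotopyBracket (r 1) (r 2) (X 1) (X 2) (f 1) (f 2)) (f 0)
      = -(1 / 2 : ℝ) • ((sgn (r 0) * sgn (r 1)) • Form.lieDeriv (D 0 1) (f 2)
        + (sgn (r 2 * r 1) * sgn (r 0) * sgn (r 2)) • Form.lieDeriv (D 0 2) (f 1)
        + (sgn (r 1 * r 0) * sgn (r 2 * r 0) * sgn (r 1) * sgn (r 2)) •
          Form.lieDeriv (D 1 2) (f 0)) := by
  have expand (i j l : Fin 3) : homotopyBracket (r i + r j - 1) (r l) (D i j) (X l)
      (homotopyBracket (r i) (r j) (X i) (X j) (f i) (f j)) (f l)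
      = sgn (r i + r j - 1) • Form.lieDeriv (D i j) (f l)
        + (sgn ((r i + r j - 1) * r l) * sgn (r l)) •
          (sgn (r i) • Form.lieDeriv (X l) (Form.lieDeriv (X i) (f j))
            + (sgn (r i * r j) * sgn (r j)) •
              Form.lieDeriv (X l) (Form.lieDeriv (X j) (f i))) := by
    rw [homotopyBracket, lieDeriv_homotopyBracket (h l).smooth_fst (h i) (h j) hω]
  have lie_D (i j l : Fin 3) :=
    lieDeriv_bracket (h i) (h j) (h l) hω hd hk (hD i j)
  have sgn_shift (i j l : Fin 3) : sgn ((r i + r j - 1) * r l)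
      = sgn (r i * r l) * sgn (r j * r l) * sgn (r l) := by
    rw [sub_mul, add_mul, sgn_sub, sgn_add, one_mul]
  simp only [expand, lie_D, sgn_shift, sgn_sub, sgn_add, sgn_one, mul_comm (r 1) (r 0),
    mul_comm (r 2) (r 0), mul_comm (r 2) (r 1)]
  have sq (i : Fin 3) := sgn_mul_self (r i)
  have sq_mul (i j : Fin 3) := sgn_mul_self (r i * r j)
  clear hD expand lie_D sgn_shift
  match_scalars <;> grind

end HamiltonianPair

end Hamiltonian

/-! ### Homogeneous components -/

section Components

variable {E : Type u} [NormedAddCommGroup E] [NormedSpace ℝ E]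
  {M : Type v} [TopologicalSpace M] [ChartedSpace E M]

theorem FormSection.toForm_self {r : ℕ} (α : FormSection E M r) : α.toForm r = α :=
  Pi.single_eq_same r α

theorem FormSection.toForm_of_ne {r k : ℕ} (α : FormSection E M r) (h : k ≠ r) :
    α.toForm k = 0 :=
  Pi.single_eq_of_ne h α

theorem FormSection.toForm_zero (r : ℕ) : (0 : FormSection E M r).toForm = 0 :=
  Pi.single_zero r

theorem FormSection.flip_toForm {r : ℕ} (α : FormSection E M r) :
    α.toForm.flip = sgn r • α.toForm := by
  funext k
  change (-1 : ℝ) ^ k • α.toForm k = sgn r • α.toForm k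
  by_cases h : k = r
  · rw [h, sgn_natCast]
  · rw [α.toForm_of_ne h, smul_zero, smul_zero]

theorem FormSection.d_zero (r : ℕ) : FormSection.d (0 : FormSection E M r) = 0 := by
  funext m
  have inChart_zero : (0 : FormSection E M r).inChart m = 0 := rfl
  have extDeriv_zero : extDeriv (0 : E → E [⋀^Fin r]→L[ℝ] ℝ) = 0 := by
    funext y
    simpa using extDeriv_smul (x := y) (0 : ℝ) (0 : E → E [⋀^Fin r]→L[ℝ] ℝ)
  rw [FormSection.d, inChart_zero, extDeriv_zero]
  rfl

theorem FormSection.d_toForm {r : ℕ} (α : FormSection E M r) : α.toForm.d = α.d.toForm := by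
  funext k
  match k with
  | 0 => exact (FormSection.toForm_of_ne _ (Nat.succ_ne_zero r).symm).symm
  | k + 1 =>
    change FormSection.d (α.toForm k) = _
    by_cases h : k = r
    · subst h
      rw [FormSection.toForm_self, FormSection.toForm_self]
    · rw [α.toForm_of_ne h, FormSection.toForm_of_ne _ (by omega), FormSection.d_zero]

theorem Form.IsHomogeneous.flip {α : Form E M} {r : ℕ} (h : α.IsHomogeneous r) :
    α.flip = sgn r • α := by
  funext k
  change (-1 : ℝ) ^ k • α k = sgn r • α k
  by_cases hk : k = r
  · rw [hk, sgn_natCast]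
  · rw [h k hk, smul_zero, smul_zero]

theorem Form.component_neg (α : Form E M) (r : ℕ) : (-α).component r = -α.component r :=
  Pi.single_neg r (α r)

theorem Form.d_component (α : Form E M) (r : ℕ) : (α.component r).d = α.d.component (r + 1) :=
  FormSection.d_toForm (α r)

theorem Form.component_eq_zero_or_sgn_eq {α : Form E M} {a : ℤ} (h : α.flip = sgn a • α)
    (r : ℕ) : α.component r = 0 ∨ sgn r = sgn a := by
  have flip_apply : (-1 : ℝ) ^ r • α r = sgn a • α r := congrFun h r
  rw [← sgn_natCast, ← sub_eq_zero] at flip_apply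
  have smul_eq : (sgn r - sgn a) • α r = 0 := (sub_smul _ _ _).trans flip_apply
  refine (smul_eq_zero.1 smul_eq).symm.imp (fun h₀ => ?_) sub_eq_zero.1
  rw [Form.component, h₀]
  exact Pi.single_zero r

theorem FormSection.IsSmooth.toForm {r : ℕ} {α : FormSection E M r} (h : α.IsSmooth) :
    α.toForm.IsSmooth := by
  intro k
  by_cases hk : k = r
  · subst hk
    rwa [FormSection.toForm_self]
  · rw [α.toForm_of_ne hk]
    exact Form.isSmooth_zero k

theorem Form.IsSmooth.component {α : Form E M} (h : α.IsSmooth) (r : ℕ) :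
    (α.component r).IsSmooth :=
  (h r).toForm

theorem Multivector.isSmooth_zero : (0 : Multivector E M).IsSmooth := by
  intro r x l
  have inChart_zero : (0 : MultivectorSection E M r).inChart x = 0 := funext fun _ => map_zero _
  change ContDiffOn ℝ _ (fun y =>
    exteriorPower.alternatingMapLinearEquiv l ((0 : MultivectorSection E M r).inChart x y)) _
  simp only [inChart_zero, Pi.zero_apply, map_zero]
  exact contDiffOn_const

theorem Multivector.exists_contract_eq_component {n : ℕ} (ω : FormSection E M n)
    {X : Multivector E M} (hX : X.IsSmooth) (k : ℕ) : ∃ X' : Multivector E M, X'.IsSmooth ∧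
      Form.contract X' ω.toForm = (Form.contract X ω.toForm).component k := by
  refine ⟨fun r => if r + k = n then X r else 0, fun r => ?_, ?_⟩
  · dsimp only
    split_ifs
    exacts [hX r, Multivector.isSmooth_zero r]
  · have contract_of_ne {r j : ℕ} (h : r + j ≠ n) (S : MultivectorSection E M r) (m : M) :
        NPlectic.contract (S m) (ω.toForm (r + j) m) = 0 := by
      rw [ω.toForm_of_ne h]
      have alternating_zero : contractAlternating
          (0 : TangentSpace 𝓘(ℝ, E) m [⋀^Fin (r + j)]→L[ℝ] ℝ) = 0 := rfl
      change exteriorPower.alternatingMapLinearEquiv (contractAlternating 0) (S m) = 0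
      rw [alternating_zero, map_zero, LinearMap.zero_apply]
    funext j m
    by_cases hj : j = k
    · subst hj
      rw [Form.component, Pi.single_eq_same]
      refine Finset.sum_congr rfl fun r _ => ?_
      by_cases h : r + j = n
      · simp only [if_pos h]
      · rw [contract_of_ne h, contract_of_ne h]
    · rw [Form.component, Pi.single_eq_of_ne hj]
      refine Finset.sum_eq_zero fun r _ => ?_
      by_cases h : r + k = n
      · exact contract_of_ne (by omega) _ m
      · simp only [if_neg h]
        exact map_zero _

variable [FiniteDimensional ℝ E]

theorem FormSection.eq_zero_of_finrank_lt {r : ℕ} (α : FormSection E M r)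
    (h : Module.finrank ℝ E < r) : α = 0 := by
  funext m
  have alternating_eq_zero (β : E [⋀^Fin r]→L[ℝ] ℝ) : β = 0 :=
    ContinuousAlternatingMap.ext fun v => β.toAlternatingMap.map_linearDependent v fun hv =>
      h.not_ge (by simpa using hv.fintype_card_le_finrank)
  exact alternating_eq_zero (α m)

theorem Form.sum_component (α : Form E M) :
    ∑ r ∈ Finset.range (Module.finrank ℝ E + 1), α.component r = α := by
  funext k
  rw [Finset.sum_apply]
  by_cases hk : k ∈ Finset.range (Module.finrank ℝ E + 1)
  · exact (Finset.sum_eq_single_of_mem k hk fun r _ hr => FormSection.toForm_of_ne _ hr.symm).trans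
      (FormSection.toForm_self (α k))
  · rw [FormSection.eq_zero_of_finrank_lt (α k) (by rw [Finset.mem_range] at hk; omega)]
    exact Finset.sum_eq_zero fun r hr => FormSection.toForm_of_ne _ fun h => hk (h ▸ hr)

end Components

/-! ### Parity parts -/

section Parity

variable {E : Type u} [NormedAddCommGroup E] [NormedSpace ℝ E]
  {M : Type v} [TopologicalSpace M] [ChartedSpace E M]

/-- The sum of the components of `X` in the tensor degrees congruent to `r` modulo two. -/
def Multivector.parityPart (r : ℤ) (X : Multivector E M) : Multivector E M :=
  (1 / 2 : ℝ) • (X + sgn r • X.flip)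

theorem Multivector.flip_flip (X : Multivector E M) : X.flip.flip = X :=
  funext fun r => (smul_smul _ _ _).trans <| by
    rw [← mul_pow, neg_one_mul, neg_neg, one_pow]
    exact one_smul ℝ (X r)

theorem Multivector.flip_parityPart (r : ℤ) (X : Multivector E M) :
    (X.parityPart r).flip = sgn r • X.parityPart r := by
  simp only [parityPart, Multivector.flip_smul, Multivector.flip_add, Multivector.flip_flip]
  have := sgn_mul_self r
  match_scalars <;> grind

theorem Multivector.IsSmooth.parityPart [FiniteDimensional ℝ E] (r : ℤ) {X : Multivector E M}
    (h : X.IsSmooth) : (X.parityPart r).IsSmooth :=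
  (h.add (h.flip.smul _)).smul _

theorem Form.contract_parityPart [FiniteDimensional ℝ E] {ω α : Form E M} {k r : ℤ}
    (hω : ω.flip = sgn k • ω) (hα : α.flip = sgn (k + r) • α) {X : Multivector E M}
    (hX : Form.contract X ω = α) : Form.contract (X.parityPart r) ω = α := by
  have contract_flip : sgn k • Form.contract X.flip ω = sgn (k + r) • α := by
    rw [← Form.contract_smul, ← hω, ← Form.flip_contract, hX, hα]
  have contract_flip' : Form.contract X.flip ω = sgn r • α := by
    have h := congrArg (sgn k • ·) contract_flip
    simp only [smul_smul, sgn_add, ← mul_assoc, sgn_mul_self, one_mul] at h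
    exact (one_smul ℝ _).symm.trans h
  rw [Multivector.parityPart, Form.smul_contract, Form.add_contract, Form.smul_contract, hX,
    contract_flip', smul_smul, sgn_mul_self]
  module

end Parity

/-! ### The 2-bracket of Hamiltonian forms -/

section Bracket

theorem sum_shuffles_two_one {A : Type*} [AddCommMonoid A] (F : Equiv.Perm (Fin 3) → A) :
    ∑ s ∈ shuffles 2 1, F s = F 1 + F (Equiv.swap 1 2) + F (Equiv.swap 0 2 * Equiv.swap 0 1) := by
  have shuffles_eq : shuffles 2 1
      = {1, Equiv.swap 1 2, (Equiv.swap 0 2 * Equiv.swap 0 1 : Equiv.Perm (Fin 3))} := by decide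
  rw [shuffles_eq, Finset.sum_insert (by decide), Finset.sum_insert (by decide),
    Finset.sum_singleton, add_assoc]

theorem koszulSign_one (deg : Fin 3 → ℤ) : koszulSign 1 deg = 1 := by
  simp [koszulSign, Fintype.prod_prod_type, Fin.prod_univ_three]

theorem koszulSign_swap (deg : Fin 3 → ℤ) :
    koszulSign (Equiv.swap 1 2) deg = sgn (deg 2 * deg 1) := by
  have swap_eq (i : Fin 3) : Equiv.swap (1 : Fin 3) 2 i = ![0, 2, 1] i := by decide +revert
  simp [koszulSign, Fintype.prod_prod_type, Fin.prod_univ_three, swap_eq, sgn, sgn₂]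

theorem koszulSign_rotate (deg : Fin 3 → ℤ) :
    koszulSign (Equiv.swap 0 2 * Equiv.swap 0 1) deg
      = sgn (deg 1 * deg 0) * sgn (deg 2 * deg 0) := by
  have rotate_eq (i : Fin 3) :
      (Equiv.swap 0 2 * Equiv.swap 0 1 : Equiv.Perm (Fin 3)) i = ![1, 2, 0] i := by decide +revert
  simp only [koszulSign, Fintype.prod_prod_type, Fin.prod_univ_three, rotate_eq]
  simp [sgn, sgn₂]

theorem sgn_mul_congr {a a' b b' : ℤ} (ha : sgn a = sgn a') (hb : sgn b = sgn b') :
    sgn (a * b) = sgn (a' * b') := by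
  have sgn_mul (a b : ℤ) : sgn (a * b) = sgn a ^ b := zpow_mul _ _ _
  rw [sgn_mul, ha, ← sgn_mul, mul_comm, sgn_mul, hb, ← sgn_mul, mul_comm]

variable {E : Type u} [NormedAddCommGroup E] [NormedSpace ℝ E]
  {M : Type v} [TopologicalSpace M] [ChartedSpace E M] {n : ℕ} {ω : FormSection E M (n + 1)}
  {f g : Form E M}

theorem IsHamiltonian.isSemiHamiltonianField (h : IsHamiltonian ω f) :
    IsSemiHamiltonianField ω f (semiHamiltonianField ω f) := by
  rw [semiHamiltonianField, dif_pos h.2.1]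
  exact h.2.1.choose_spec

theorem IsHamiltonian.component (h : IsHamiltonian ω f) (r : ℕ) :
    IsHamiltonian ω (f.component r) := by
  obtain ⟨hf, ⟨X, hX, hXf⟩, Y, hY, hYf⟩ := h
  obtain ⟨X', hX', hXf'⟩ := Multivector.exists_contract_eq_component ω hX (r + 1)
  obtain ⟨Y', hY', hYf'⟩ := Multivector.exists_contract_eq_component ω hY r
  exact ⟨hf.component r, ⟨X', hX', by rw [hXf', hXf, Form.component_neg, Form.d_component]⟩,
    Y', hY', by rw [hYf', hYf, Form.component_neg]⟩

theorem Form.IsHomogeneous.flip_symDeg {a : ℕ} (ha : f.IsHomogeneous a) (n : ℕ) :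
    f.flip = sgn (n - symDeg n a) • f := by
  rw [symDeg, sub_sub_cancel, ha.flip]

theorem FormSection.d_toForm_eq_zero (hd : FormSection.d ω = 0) : ω.toForm.d = 0 := by
  rw [FormSection.d_toForm, hd, FormSection.toForm_zero]

variable [FiniteDimensional ℝ E]

theorem Form.zero_contract (α : Form E M) : Form.contract (0 : Multivector E M) α = 0 := by
  simpa using Form.add_contract (0 : Multivector E M) 0 α

theorem IsHamiltonian.lieDeriv_eq (hf : IsHamiltonian ω f) {X X' : Multivector E M}
    (hX : Form.contract X ω.toForm = Form.contract X' ω.toForm) :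
    Form.lieDeriv X f = Form.lieDeriv X' f := by
  obtain ⟨-, ⟨_, -, hY⟩, _, -, hZ⟩ := hf
  exact Form.lieDeriv_eq_of_contract_eq ω.flip_toForm hX hY hZ

variable [IsManifold 𝓘(ℝ, E) (⊤ : ℕ∞) M]

theorem Form.flip_d {α : Form E M} (hα : α.IsSmooth) : α.d.flip = -α.flip.d := by
  funext r
  match r with
  | 0 => exact (smul_zero _).trans neg_zero.symm
  | r + 1 =>
    have d_smul : FormSection.d ((-1 : ℝ) ^ r • α r) = (-1 : ℝ) ^ r • FormSection.d (α r) :=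
      congrFun (Form.d_smul hα ((-1) ^ r)) (r + 1)
    change (-1 : ℝ) ^ (r + 1) • FormSection.d (α r) = -FormSection.d ((-1 : ℝ) ^ r • α r)
    rw [d_smul, pow_succ]
    module

theorem HamiltonianPair.isHamiltonian {r : ℤ} {X Y : Multivector E M}
    (h : HamiltonianPair ω.toForm f r X Y) (hω : ω.IsSmooth) : IsHamiltonian ω f :=
  ⟨h.isSmooth hω.toForm, ⟨X, h.smooth_fst, h.contract_fst⟩, Y, h.smooth_snd, h.contract_snd⟩

theorem IsHamiltonian.exists_hamiltonianPair (hf : IsHamiltonian ω f) {r : ℤ}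
    (hr : f.flip = sgn (n - r) • f) : ∃ X Y, HamiltonianPair ω.toForm f r X Y := by
  obtain ⟨smooth, ⟨X, hX, hXf⟩, Y, hY, hYf⟩ := hf
  refine ⟨X.parityPart r, Y.parityPart (r + 1), hX.parityPart r, hY.parityPart _,
    X.flip_parityPart _, Y.flip_parityPart _, Form.contract_parityPart ω.flip_toForm ?_ hXf,
    Form.contract_parityPart ω.flip_toForm ?_ hYf⟩
  · rw [Form.neg_eq_smul, Form.flip_smul, Form.flip_d smooth, hr, Form.d_smul smooth]
    simp only [Nat.cast_succ, sgn_add, sgn_sub, sgn_one]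
    module
  · rw [Form.neg_eq_smul, Form.flip_smul, hr]
    simp only [Nat.cast_succ, sgn_add, sgn_sub, sgn_one]
    module

theorem Form.d_zero : Form.d (0 : Form E M) = 0 := by
  simpa using Form.d_add (Form.isSmooth_zero (E := E) (M := M)) Form.isSmooth_zero

theorem Form.lieDeriv_zero (X : Multivector E M) : Form.lieDeriv X 0 = 0 := by
  change (Form.contract X 0).d - Form.contract X.flip (Form.d 0) = 0
  rw [Form.contract_zero, Form.d_zero, Form.contract_zero, sub_zero]

theorem Form.zero_lieDeriv (α : Form E M) : Form.lieDeriv (0 : Multivector E M) α = 0 := by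
  change (Form.contract 0 α).d - Form.contract (Multivector.flip 0) α.d = 0
  have flip_zero : (0 : Multivector E M).flip = 0 := funext fun _ => smul_zero _
  rw [flip_zero, Form.zero_contract, Form.zero_contract, Form.d_zero, sub_zero]

variable {ι : Type*}

theorem Form.lieDeriv_sum {X : Multivector E M} (hX : X.IsSmooth) {α : ι → Form E M}
    (hα : ∀ i, (α i).IsSmooth) (s : Finset ι) :
    Form.lieDeriv X (∑ i ∈ s, α i) = ∑ i ∈ s, Form.lieDeriv X (α i) :=
  (Finset.sum_hom_rel (r := fun β γ => β.IsSmooth ∧ Form.lieDeriv X β = γ)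
    ⟨Form.isSmooth_zero, Form.lieDeriv_zero X⟩ fun i _ _ h =>
      ⟨(hα i).add h.1, by rw [Form.lieDeriv_add hX (hα i) h.1, h.2]⟩).2

theorem Form.sum_lieDeriv {X : ι → Multivector E M} (hX : ∀ i, (X i).IsSmooth) {α : Form E M}
    (hα : α.IsSmooth) (s : Finset ι) :
    Form.lieDeriv (∑ i ∈ s, X i) α = ∑ i ∈ s, Form.lieDeriv (X i) α :=
  (Finset.sum_hom_rel (r := fun Y β => Y.IsSmooth ∧ Form.lieDeriv Y α = β)
    ⟨Multivector.isSmooth_zero, Form.zero_lieDeriv α⟩ fun i _ _ h =>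
      ⟨(hX i).add h.1, by rw [Form.add_lieDeriv (hX i) h.1 hα, h.2]⟩).2

theorem IsSemiHamiltonianField.sum {α : ι → Form E M} {X : ι → Multivector E M}
    (hα : ∀ i, (α i).IsSmooth) (hX : ∀ i, IsSemiHamiltonianField ω (α i) (X i)) (s : Finset ι) :
    IsSemiHamiltonianField ω (∑ i ∈ s, α i) (∑ i ∈ s, X i) :=
  (Finset.sum_hom_rel (r := fun β Y => β.IsSmooth ∧ IsSemiHamiltonianField ω β Y)
    ⟨Form.isSmooth_zero, Multivector.isSmooth_zero,
      by rw [Form.zero_contract, Form.d_zero, neg_zero]⟩ fun i _ _ h =>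
      ⟨(hα i).add h.1, (hX i).1.add h.2.1,
        by rw [Form.add_contract, (hX i).2, h.2.2, Form.d_add (hα i) h.1, neg_add]⟩).2

theorem IsHamiltonian.sum_lieDeriv_component (hf : IsHamiltonian ω f) (hg : IsHamiltonian ω g)
    {X : Multivector E M} (hX : IsSemiHamiltonianField ω f X) :
    ∑ a ∈ Finset.range (Module.finrank ℝ E + 1), ∑ b ∈ Finset.range (Module.finrank ℝ E + 1),
      Form.lieDeriv (semiHamiltonianField ω (f.component a)) (g.component b)
      = Form.lieDeriv X g := by
  have hX' (a : ℕ) := (hf.component a).isSemiHamiltonianField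
  have sum_field := IsSemiHamiltonianField.sum (fun a => (hf.component a).1) hX'
    (Finset.range (Module.finrank ℝ E + 1))
  rw [Form.sum_component] at sum_field
  simp only [← Form.lieDeriv_sum (hX' _).1 fun b => (hg.component b).1, Form.sum_component]
  rw [← Form.sum_lieDeriv (fun a => (hX' a).1) hg.1]
  exact hg.lieDeriv_eq (sum_field.2.trans hX.2.symm)

theorem IsHamiltonian.lieDeriv_semiHamiltonianField_zero (hf : IsHamiltonian ω f) :
    Form.lieDeriv (semiHamiltonianField ω 0) f = 0 := by
  have isHamiltonian_zero : IsHamiltonian ω (0 : Form E M) := by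
    have contract_zero : Form.contract 0 ω.toForm = -(0 : Form E M) := by
      rw [Form.zero_contract, neg_zero]
    exact ⟨Form.isSmooth_zero, ⟨0, Multivector.isSmooth_zero, by rwa [Form.d_zero]⟩,
      0, Multivector.isSmooth_zero, contract_zero⟩
  rw [hf.lieDeriv_eq (X' := 0), Form.zero_lieDeriv]
  rw [isHamiltonian_zero.isSemiHamiltonianField.2, Form.d_zero, neg_zero, Form.zero_contract]

theorem D₂_eq (hf : IsHamiltonian ω f) (hg : IsHamiltonian ω g) {r s : ℤ}
    (hr : f.flip = sgn (n - r) • f) (hs : g.flip = sgn (n - s) • g) {X Y : Multivector E M}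
    (hX : IsSemiHamiltonianField ω f X) (hY : IsSemiHamiltonianField ω g Y) :
    D₂ ω f g = homotopyBracket r s X Y f g := by
  have sgn_symDeg {a : ℕ} {t : ℤ} (h : sgn a = sgn (n - t)) : sgn (symDeg n a) = sgn t := by
    rw [symDeg, sgn_sub, h, sgn_sub, ← mul_assoc, sgn_mul_self, one_mul]
  have bracket_component (a b : ℕ) : sgn (symDeg n a) •
        Form.lieDeriv (semiHamiltonianField ω (f.component a)) (g.component b)
      + (sgn₂ (symDeg n a) (symDeg n b) * sgn (symDeg n b)) •
        Form.lieDeriv (semiHamiltonianField ω (g.component b)) (f.component a)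
      = sgn r • Form.lieDeriv (semiHamiltonianField ω (f.component a)) (g.component b)
        + (sgn (r * s) * sgn s) •
          Form.lieDeriv (semiHamiltonianField ω (g.component b)) (f.component a) := by
    obtain f_zero | ha := Form.component_eq_zero_or_sgn_eq hr a
    · rw [f_zero, (hg.component b).lieDeriv_semiHamiltonianField_zero, Form.lieDeriv_zero]
      module
    obtain g_zero | hb := Form.component_eq_zero_or_sgn_eq hs b
    · rw [g_zero, (hf.component a).lieDeriv_semiHamiltonianField_zero, Form.lieDeriv_zero]
      module
    rw [show sgn₂ (symDeg n a) (symDeg n b) = sgn (symDeg n a * symDeg n b) from rfl,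
      sgn_mul_congr (sgn_symDeg ha) (sgn_symDeg hb), sgn_symDeg ha, sgn_symDeg hb]
  simp only [D₂, bracket_component, Finset.sum_add_distrib, ← Finset.smul_sum]
  rw [hf.sum_lieDeriv_component hg hX, Finset.sum_comm, hg.sum_lieDeriv_component hf hY,
    homotopyBracket]

theorem exists_hamiltonianPair_D₂ (hω : ω.IsSmooth) (hd : FormSection.d ω = 0)
    (hf : IsHamiltonian ω f) (hg : IsHamiltonian ω g) {r s : ℤ}
    (hr : f.flip = sgn (n - r) • f) (hs : g.flip = sgn (n - s) • g) :
    ∃ X Y, HamiltonianPair ω.toForm (D₂ ω f g) (r + s - 1) X Y := by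
  obtain ⟨X, X', hX⟩ := hf.exists_hamiltonianPair hr
  obtain ⟨Y, Y', hY⟩ := hg.exists_hamiltonianPair hs
  rw [D₂_eq hf hg hr hs ⟨hX.smooth_fst, hX.contract_fst⟩ ⟨hY.smooth_fst, hY.contract_fst⟩]
  exact ⟨_, _, hX.bracket hY hω.toForm (FormSection.d_toForm_eq_zero hd)⟩

theorem isHamiltonian_D₂ (hω : ω.IsSmooth) (hd : FormSection.d ω = 0)
    (hf : IsHamiltonian ω f) (hg : IsHamiltonian ω g) {r s : ℤ}
    (hr : f.flip = sgn (n - r) • f) (hs : g.flip = sgn (n - s) • g) :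
    IsHamiltonian ω (D₂ ω f g) := by
  obtain ⟨X, Y, h⟩ := exists_hamiltonianPair_D₂ hω hd hf hg hr hs
  exact h.isHamiltonian hω

theorem flip_D₂ (hω : ω.IsSmooth) (hd : FormSection.d ω = 0)
    (hf : IsHamiltonian ω f) (hg : IsHamiltonian ω g) {r s : ℤ}
    (hr : f.flip = sgn (n - r) • f) (hs : g.flip = sgn (n - s) • g) :
    (D₂ ω f g).flip = sgn (n - (r + s - 1)) • D₂ ω f g := by
  obtain ⟨X, Y, h⟩ := exists_hamiltonianPair_D₂ hω hd hf hg hr hs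
  rw [h.flip_eq ω.flip_toForm]
  congr 2
  push_cast
  ring

theorem jacobiator_eq (hω : ω.IsSmooth) (hd : FormSection.d ω = 0) {a : Fin 3 → ℕ}
    {f : Fin 3 → Form E M} (hf : ∀ i, IsHamiltonian ω (f i))
    (ha : ∀ i, (f i).IsHomogeneous (a i)) {XD : Fin 3 → Fin 3 → Multivector E M}
    (hXD : ∀ i j, IsSemiHamiltonianField ω (D₂ ω (f i) (f j)) (XD i j)) :
    jacobiator ω a f = -(1 / 2 : ℝ) • ∑ s ∈ shuffles 2 1,
      (koszulSign s (fun i => symDeg n (a i)) *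
          sgn (symDeg n (a (s 0))) * sgn (symDeg n (a (s 1)))) •
        Form.lieDeriv (XD (s 0) (s 1)) (f (s 2)) := by
  have hr (i : Fin 3) := (ha i).flip_symDeg n
  choose X Y h using fun i => (hf i).exists_hamiltonianPair (hr i)
  have hX (i : Fin 3) : IsSemiHamiltonianField ω (f i) (X i) :=
    ⟨(h i).smooth_fst, (h i).contract_fst⟩
  have D₂_apply (i j : Fin 3) := D₂_eq (hf i) (hf j) (hr i) (hr j) (hX i) (hX j)
  have D₂_D₂_apply (i j l : Fin 3) := D₂_eq
    (isHamiltonian_D₂ hω hd (hf i) (hf j) (hr i) (hr j)) (hf l)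
    (flip_D₂ hω hd (hf i) (hf j) (hr i) (hr j)) (hr l) (hXD i j) (hX l)
  simp only [jacobiator, D₂_D₂_apply]
  simp only [D₂_apply]
  have key := HamiltonianPair.jacobi h hω.toForm (FormSection.d_toForm_eq_zero hd)
    ω.flip_toForm (D := XD) fun i j => by rw [(hXD i j).2, D₂_apply]
  rw [sum_shuffles_two_one, sum_shuffles_two_one, koszulSign_one, koszulSign_swap,
    koszulSign_rotate, one_mul]
  exact (congrArg (· + _ + _) (one_smul ℝ _)).trans key

end Bracket

/-! ### Fields with constant directions on a vector space -/

section ModelSpace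

open ExteriorAlgebra (ιMulti)

variable {V : Type u} [NormedAddCommGroup V] [NormedSpace ℝ V] {r k : ℕ}

theorem chartDeriv_self (x m : V) : chartDeriv x m = ContinuousLinearMap.id ℝ V := by
  rw [chartDeriv, extChartAt_model_space_eq_id]
  exact mfderiv_id

theorem chartSymmDeriv_self (x m : V) : chartSymmDeriv x m = ContinuousLinearMap.id ℝ V := by
  rw [chartSymmDeriv, extChartAt_model_space_eq_id]
  exact mfderiv_id

/-- The `r`-form `φ c` for a function `φ` and a constant form `c`, as a section. -/
def scaledSection (φ : V → ℝ) (c : V [⋀^Fin r]→L[ℝ] ℝ) : FormSection V V r := fun m => φ m • c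

/-- The `r`-form `φ c` for a function `φ` and a constant form `c`. -/
def scaledForm (φ : V → ℝ) (c : V [⋀^Fin r]→L[ℝ] ℝ) : Form V V := (scaledSection φ c).toForm

/-- The multivector field `φ (w_1 ∧ ⋯ ∧ w_r)` for a function `φ` and constant vectors `w_i`. -/
def scaledField (φ : V → ℝ) (w : Fin r → V) : Multivector V V :=
  Pi.single (M := MultivectorSection V V) r fun m => φ m • exteriorPower.ιMulti ℝ r w

theorem inChart_scaledSection (φ : V → ℝ) (c : V [⋀^Fin r]→L[ℝ] ℝ) (x : V) :
    (scaledSection φ c).inChart x = fun m => φ m • c := by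
  funext m
  change (φ ((extChartAt 𝓘(ℝ, V) x).symm m) • c).compContinuousLinearMap (chartSymmDeriv x m) = _
  rw [chartSymmDeriv_self, extChartAt_model_space_eq_id]
  rfl

theorem isSmooth_scaledSection {φ : V → ℝ} (hφ : ContDiff ℝ (⊤ : ℕ∞) φ)
    (c : V [⋀^Fin r]→L[ℝ] ℝ) : (scaledSection φ c).IsSmooth := fun x => by
  rw [inChart_scaledSection]
  exact (hφ.smul contDiff_const).contDiffOn

theorem d_scaledSection {φ ψ : V → ℝ} {φ' : V → V →L[ℝ] ℝ} (hφ : ∀ m, HasFDerivAt φ (φ' m) m)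
    {c : V [⋀^Fin r]→L[ℝ] ℝ} {c' : V [⋀^Fin (r + 1)]→L[ℝ] ℝ}
    (h : ∀ m, .alternatizeUncurryFin ((φ' m).smulRight c) = ψ m • c') :
    (scaledSection φ c).d = scaledSection ψ c' := by
  funext m
  change (extDeriv ((scaledSection φ c).inChart m)
    (extChartAt 𝓘(ℝ, V) m m)).compContinuousLinearMap (chartDeriv m m) = ψ m • c'
  rw [inChart_scaledSection, chartDeriv_self, extChartAt_model_space_eq_id]
  refine Eq.trans ?_ (h m)
  rw [← ((hφ m).smul_const c).fderiv]
  rfl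

theorem d_scaledForm {φ ψ : V → ℝ} {φ' : V → V →L[ℝ] ℝ} (hφ : ∀ m, HasFDerivAt φ (φ' m) m)
    {c : V [⋀^Fin r]→L[ℝ] ℝ} {c' : V [⋀^Fin (r + 1)]→L[ℝ] ℝ}
    (h : ∀ m, .alternatizeUncurryFin ((φ' m).smulRight c) = ψ m • c') :
    (scaledForm φ c).d = scaledForm ψ c' := by
  rw [scaledForm, FormSection.d_toForm, d_scaledSection hφ h, scaledForm]

theorem smul_scaledForm (a : ℝ) (φ : V → ℝ) (c : V [⋀^Fin r]→L[ℝ] ℝ) :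
    a • scaledForm φ c = scaledForm (fun m => a * φ m) c := by
  rw [scaledForm, scaledForm, FormSection.toForm, FormSection.toForm, ← Pi.single_smul]
  congr 1
  funext m
  exact (mul_smul a (φ m) c).symm

theorem neg_scaledForm (φ : V → ℝ) (c : V [⋀^Fin r]→L[ℝ] ℝ) :
    -scaledForm φ c = scaledForm (fun m => -φ m) c := by
  rw [Form.neg_eq_smul, smul_scaledForm]
  simp only [neg_one_mul]

theorem scaledForm_zero (c : V [⋀^Fin r]→L[ℝ] ℝ) : scaledForm (fun _ => 0) c = 0 := by
  rw [scaledForm, show scaledSection (fun _ => 0) c = 0 from funext fun _ => zero_smul ℝ c,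
    FormSection.toForm_zero]

theorem pairing_single_ιMulti_mul (w : Fin r → V) (c : V [⋀^Fin (r + k)]→L[ℝ] ℝ)
    (z : ExteriorAlgebra ℝ V) :
    pairing (Pi.single (r + k) c) (ιMulti ℝ r w * z)
      = pairing (Pi.single k (contractTuple c w)) z := by
  have : pairing (Pi.single (r + k) c) ∘ₗ LinearMap.mulLeft ℝ (ιMulti ℝ r w)
      = pairing (Pi.single k (contractTuple c w)) := linearMap_ext_ιMulti fun j v => by
    rw [LinearMap.comp_apply, LinearMap.mulLeft_apply, ExteriorAlgebra.ιMulti_mul_ιMulti,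
      pairing_ιMulti, pairing_ιMulti]
    obtain rfl | hj := eq_or_ne j k
    · rw [Pi.single_eq_same, Pi.single_eq_same]
      rfl
    · rw [Pi.single_eq_of_ne hj, Pi.single_eq_of_ne (by omega)]
      rfl
  exact LinearMap.congr_fun this z

variable [FiniteDimensional ℝ V]

theorem value_scaledField (φ : V → ℝ) (w : Fin r → V) (m : V) :
    (scaledField φ w).value m = φ m • ιMulti ℝ r w := by
  have component_self : scaledField φ w r m = φ m • exteriorPower.ιMulti ℝ r w :=
    congrFun (Pi.single_eq_same (M := MultivectorSection V V) r _) m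
  have component_of_ne (k : ℕ) (hk : k ≠ r) : (scaledField φ w).fiber m k = 0 :=
    congrFun (Pi.single_eq_of_ne (M := MultivectorSection V V) hk _) m
  rw [Multivector.value, total_apply]
  refine (Finset.sum_eq_single r (fun k _ hk => ?_) fun hr => ?_).trans
    (congrArg Subtype.val component_self)
  · rw [component_of_ne k hk, Submodule.coe_zero]
  · rw [exteriorPower_eq_zero_of_finrank_lt (by simpa using hr) ((scaledField φ w).fiber m r),
      Submodule.coe_zero]

theorem flip_scaledField (φ : V → ℝ) (w : Fin r → V) :
    (scaledField φ w).flip = sgn r • scaledField φ w := by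
  refine Multivector.ext_value fun m => ?_
  rw [Multivector.value_flip, Multivector.value_smul, value_scaledField, map_smul,
    involute_ιMulti, sgn_natCast, smul_comm]

theorem isSmooth_scaledField {φ : V → ℝ} (hφ : ContDiff ℝ (⊤ : ℕ∞) φ) (w : Fin r → V) :
    (scaledField φ w).IsSmooth := Multivector.isSmooth_iff.2 fun x => by
  have loc_eq (y : V) : (scaledField φ w).loc x y = φ y • ιMulti ℝ r w := by
    rw [Multivector.loc, chartDeriv_self, exteriorMap_id, extChartAt_model_space_eq_id]
    exact value_scaledField φ w y
  rw [funext loc_eq]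
  exact (hφ.smul contDiff_const).contDiffOn

theorem value_scaledForm (φ : V → ℝ) (c : V [⋀^Fin r]→L[ℝ] ℝ) (m : V) :
    (scaledForm φ c).value m = φ m • pairingEquiv (Pi.single r c) := by
  have fiber_eq : (scaledForm φ c).fiber m = φ m • Pi.single r c := by
    funext k
    obtain rfl | hk := eq_or_ne k r
    · rw [Pi.smul_apply, Pi.single_eq_same]
      exact congrFun (FormSection.toForm_self _) m
    · rw [Pi.smul_apply, Pi.single_eq_of_ne hk, smul_zero]
      exact congrFun (FormSection.toForm_of_ne _ hk) m
  rw [Form.value, fiber_eq, map_smul]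

theorem contract_scaledField_zero (φ ψ : V → ℝ) (c : V [⋀^Fin k]→L[ℝ] ℝ) :
    Form.contract (scaledField φ ![]) (scaledForm ψ c) = scaledForm (fun m => φ m * ψ m) c := by
  refine Form.ext_value fun m => ContinuousLinearMap.ext fun z => ?_
  rw [Form.value_contract_apply, value_scaledField, ExteriorAlgebra.ιMulti_zero_apply,
    smul_one_mul, map_smul, value_scaledForm, value_scaledForm, mul_smul]
  rfl

theorem contract_scaledField (φ ψ : V → ℝ) (w : Fin r → V) (c : V [⋀^Fin (r + k)]→L[ℝ] ℝ) :
    Form.contract (scaledField φ w) (scaledForm ψ c)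
      = scaledForm (fun m => φ m * ψ m) (contractTuple c w) := by
  refine Form.ext_value fun m => ContinuousLinearMap.ext fun z => ?_
  rw [Form.value_contract_apply, value_scaledField, smul_mul_assoc, map_smul, value_scaledForm,
    value_scaledForm, mul_smul]
  exact congrArg (φ m • ψ m • ·) (pairing_single_ιMulti_mul w c z)

end ModelSpace

/-! ### Failure of the graded Jacobi identity on the plane -/

namespace PlaneArea

open ContinuousAlternatingMap (alternatizeUncurryFin alternatizeUncurryFin_apply)

/-- The plane, with coordinates `x = m 0` and `y = m 1` of a point `m`. -/
abbrev Plane : Type := EuclideanSpace ℝ (Fin 2)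

/-- The constant `0`-form `1`. -/
def one : Plane [⋀^Fin 0]→L[ℝ] ℝ := .constOfIsEmpty ℝ Plane (Fin 0) 1

/-- The constant form `dy`. -/
def dy : Plane [⋀^Fin 1]→L[ℝ] ℝ :=
  .ofSubsingleton ℝ Plane ℝ (0 : Fin 1) (EuclideanSpace.proj 1)

/-- The area form `dx ∧ dy`. -/
def area : Plane [⋀^Fin 2]→L[ℝ] ℝ :=
  alternatizeUncurryFin ((EuclideanSpace.proj 0).smulRight dy)

/-- The vector `∂x`. -/
def ex : Plane := !₂[1, 0]

/-- The vector `∂y`. -/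
def ey : Plane := !₂[0, 1]

/-- The area form, as a `1`-plectic form on the plane. -/
def ω : FormSection Plane Plane (1 + 1) := scaledSection (fun _ => 1) area

theorem one_apply (v : Fin 0 → Plane) : one v = 1 := rfl

theorem dy_apply (v : Fin 1 → Plane) : dy v = v 0 1 := rfl

theorem area_apply (v : Fin 2 → Plane) : area v = v 0 0 * v 1 1 - v 1 0 * v 0 1 := by
  simp only [area, alternatizeUncurryFin_apply, Nat.reduceAdd, Fin.sum_univ_two,
    Fin.coe_ofNat_eq_mod, Nat.zero_mod, Nat.mod_succ, pow_zero, pow_one, one_smul, neg_smul,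
    Fin.removeNth, Fin.zero_succAbove, Fin.succ_zero_eq_one, ne_eq, one_ne_zero,
    not_false_eq_true, Fin.succAbove_ne_zero_zero, ContinuousLinearMap.smulRight_apply,
    PiLp.proj_apply, ContinuousAlternatingMap.coe_smul, Pi.smul_apply, smul_eq_mul, dy_apply]
  ring

theorem contractTuple_area_ex : contractTuple (r := 1) (k := 1) area ![ex] = dy := by
  ext v
  change area (Fin.append ![ex] v) = dy v
  simp [area_apply, dy_apply, ex, Fin.append, Fin.addCases]

theorem contractTuple_area_ex_ey : contractTuple (r := 2) (k := 0) area ![ex, ey] = one := by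
  ext v
  change area (Fin.append ![ex, ey] v) = one v
  simp [area_apply, one_apply, ex, ey, Fin.append, Fin.addCases]

theorem contract_function_ω (φ : Plane → ℝ) :
    Form.contract (scaledField φ ![]) ω.toForm = scaledForm φ area := by
  refine (contract_scaledField_zero φ _ area).trans ?_
  simp only [mul_one]

theorem contract_ex_ω (φ : Plane → ℝ) :
    Form.contract (scaledField φ ![ex]) ω.toForm = scaledForm φ dy := by
  refine (contract_scaledField (k := 1) φ _ ![ex] area).trans ?_
  simp only [mul_one, contractTuple_area_ex]

theorem contract_ex_ey_ω (φ : Plane → ℝ) :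
    Form.contract (scaledField φ ![ex, ey]) ω.toForm = scaledForm φ one := by
  refine (contract_scaledField (k := 0) φ _ ![ex, ey] area).trans ?_
  simp only [mul_one, contractTuple_area_ex_ey]

theorem d_scaledForm_one {φ b : Plane → ℝ}
    (h : ∀ m, HasFDerivAt φ (b m • EuclideanSpace.proj 1 : Plane →L[ℝ] ℝ) m) :
    (scaledForm φ one).d = scaledForm b dy :=
  d_scaledForm h fun m => by
    ext v
    simp [alternatizeUncurryFin_apply, one_apply, dy_apply]

theorem d_scaledForm_dy {φ a b : Plane → ℝ}
    (h : ∀ m, HasFDerivAt φ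
      (a m • EuclideanSpace.proj 0 + b m • EuclideanSpace.proj 1 : Plane →L[ℝ] ℝ) m) :
    (scaledForm φ dy).d = scaledForm a area :=
  d_scaledForm h fun m => by
    ext v
    simp only [alternatizeUncurryFin_apply, Nat.reduceAdd, Fin.sum_univ_two,
      Fin.coe_ofNat_eq_mod, Nat.zero_mod, Nat.mod_succ, pow_zero, pow_one, one_smul, neg_smul,
      Fin.removeNth, Fin.zero_succAbove, Fin.succ_zero_eq_one, ne_eq, one_ne_zero,
      not_false_eq_true, Fin.succAbove_ne_zero_zero, ContinuousLinearMap.smulRight_apply,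
      add_apply, smul_apply, PiLp.proj_apply, ContinuousAlternatingMap.coe_smul, Pi.smul_apply,
      smul_eq_mul, dy_apply, area_apply]
    ring

theorem eq_of_area_eq {v w : Plane} (h : ∀ z, area ![v, z] = area ![w, z]) : v = w := by
  have hx := h ey
  have hy := h ex
  simp only [area_apply, ex, ey] at hx hy
  ext i
  fin_cases i
  · simpa using hx
  · simpa using hy

theorem isNPlectic_ω : IsNPlectic ω where
  one_le := le_rfl
  smooth := isSmooth_scaledSection contDiff_const area
  closed := by
    have d_area : ω.d = scaledSection (fun _ => 0) (0 : Plane [⋀^Fin 3]→L[ℝ] ℝ) :=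
      d_scaledSection (φ' := fun _ => 0) (fun m => hasFDerivAt_const 1 m) fun _ => by
        ext v
        simp [alternatizeUncurryFin_apply]
    rw [d_area]
    exact funext fun _ => zero_smul ℝ (0 : Plane [⋀^Fin 3]→L[ℝ] ℝ)
  nondegenerate m v w h := eq_of_area_eq fun z => by
    have contract_eq : (1 : ℝ) * area ![v, z] = 1 * area ![w, z] := DFunLike.congr_fun h ![z]
    rwa [one_mul, one_mul] at contract_eq

theorem hamiltonianPair_dy {φ a : Plane → ℝ} (hφ : ContDiff ℝ (⊤ : ℕ∞) φ)
    (ha : ContDiff ℝ (⊤ : ℕ∞) a) (h : (scaledForm φ dy).d = scaledForm a area) :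
    HamiltonianPair ω.toForm (scaledForm φ dy) 0 (scaledField (fun m => -a m) ![])
      (scaledField (fun m => -φ m) ![ex]) where
  smooth_fst := isSmooth_scaledField ha.neg _
  smooth_snd := isSmooth_scaledField hφ.neg _
  flip_fst := flip_scaledField _ _
  flip_snd := flip_scaledField _ _
  contract_fst := by rw [contract_function_ω, h, neg_scaledForm]
  contract_snd := by rw [contract_ex_ω, neg_scaledForm]

theorem hamiltonianPair_one {φ b : Plane → ℝ} (hφ : ContDiff ℝ (⊤ : ℕ∞) φ)
    (hb : ContDiff ℝ (⊤ : ℕ∞) b) (h : (scaledForm φ one).d = scaledForm b dy) :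
    HamiltonianPair ω.toForm (scaledForm φ one) 1 (scaledField (fun m => -b m) ![ex])
      (scaledField (fun m => -φ m) ![ex, ey]) where
  smooth_fst := isSmooth_scaledField hb.neg _
  smooth_snd := isSmooth_scaledField hφ.neg _
  flip_fst := flip_scaledField _ _
  flip_snd := flip_scaledField _ _
  contract_fst := by rw [contract_ex_ω, h, neg_scaledForm]
  contract_snd := by rw [contract_ex_ey_ω, neg_scaledForm]

theorem hasFDerivAt_coord (i : Fin 2) (m : Plane) :
    HasFDerivAt (fun m : Plane => m i) (EuclideanSpace.proj i : Plane →L[ℝ] ℝ) m :=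
  (EuclideanSpace.proj i : Plane →L[ℝ] ℝ).hasFDerivAt

theorem contDiff_coord (i : Fin 2) : ContDiff ℝ (⊤ : ℕ∞) fun m : Plane => m i :=
  (EuclideanSpace.proj i : Plane →L[ℝ] ℝ).contDiff

/-- The forms `x² dy`, `y²` and `1`. -/
def f : Fin 3 → Form Plane Plane :=
  ![scaledForm (fun m => m 0 ^ 2) dy, scaledForm (fun m => m 1 ^ 2) one,
    scaledForm (fun _ => 1) one]

/-- The tensor degrees of the forms `f`. -/
def deg : Fin 3 → ℕ := ![1, 0, 0]

/-- Semi-Hamiltonian multivector fields associated to the forms `f`. -/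
def X : Fin 3 → Multivector Plane Plane :=
  ![scaledField (fun m => -(2 * m 0)) ![], scaledField (fun m => -(2 * m 1)) ![ex],
    scaledField (fun _ => -0) ![ex]]

/-- Hamiltonian multivector fields associated to the forms `f`. -/
def Y : Fin 3 → Multivector Plane Plane :=
  ![scaledField (fun m => -m 0 ^ 2) ![ex], scaledField (fun m => -m 1 ^ 2) ![ex, ey],
    scaledField (fun _ => -1) ![ex, ey]]

theorem hamiltonianPair_f :
    ∀ i, HamiltonianPair ω.toForm (f i) (symDeg 1 (deg i)) (X i) (Y i) := by
  have d_zero : (f 0).d = scaledForm (fun m => 2 * m 0) area :=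
    d_scaledForm_dy (b := fun _ => 0) fun m => by
      refine ((hasFDerivAt_coord 0 m).pow 2).congr_fderiv ?_
      ext v
      simp
  have d_one : (f 1).d = scaledForm (fun m => 2 * m 1) dy :=
    d_scaledForm_one fun m => ((hasFDerivAt_coord 1 m).pow 2).congr_fderiv (by ext v; simp)
  have d_two : (f 2).d = scaledForm (fun _ => 0) dy :=
    d_scaledForm_one fun m => (hasFDerivAt_const 1 m).congr_fderiv (zero_smul ℝ _).symm
  rw [Fin.forall_fin_succ, Fin.forall_fin_two]
  exact ⟨
    hamiltonianPair_dy ((contDiff_coord 0).pow 2) (contDiff_const.mul (contDiff_coord 0)) d_zero,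
    hamiltonianPair_one ((contDiff_coord 1).pow 2) (contDiff_const.mul (contDiff_coord 1)) d_one,
    hamiltonianPair_one contDiff_const contDiff_const d_two⟩

theorem isHamiltonian_f (i : Fin 3) : IsHamiltonian ω (f i) :=
  (hamiltonianPair_f i).isHamiltonian isNPlectic_ω.smooth

theorem isHomogeneous_f : ∀ i, (f i).IsHomogeneous (deg i) := by
  rw [Fin.forall_fin_succ, Fin.forall_fin_two]
  exact ⟨fun _ => FormSection.toForm_of_ne _, fun _ => FormSection.toForm_of_ne _,
    fun _ => FormSection.toForm_of_ne _⟩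

theorem d_D₂_f (i j : Fin 3) :
    (D₂ ω (f i) (f j)).d = (2 : ℝ) • (Form.contract (X i) (Form.contract (X j) ω.toForm)).d := by
  have hi := hamiltonianPair_f i
  have hj := hamiltonianPair_f j
  have smooth := isNPlectic_ω.smooth.toForm
  have closed := FormSection.d_toForm_eq_zero isNPlectic_ω.closed
  rw [D₂_eq (isHamiltonian_f i) (isHamiltonian_f j) ((isHomogeneous_f i).flip_symDeg 1)
      ((isHomogeneous_f j).flip_symDeg 1) ⟨hi.smooth_fst, hi.contract_fst⟩
      ⟨hj.smooth_fst, hj.contract_fst⟩,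
    hi.d_homotopyBracket hj smooth closed, hi.contract_schoutenBracket_eq_d hj smooth closed]

theorem d_D₂_f_zero_one : (D₂ ω (f 0) (f 1)).d = scaledForm (fun m => 2 * (4 * m 1)) area := by
  have contract_eq : Form.contract (X 0) (Form.contract (X 1) ω.toForm)
      = scaledForm (fun m => -(2 * m 0) * -(2 * m 1)) dy := by
    rw [show X 1 = scaledField (fun m => -(2 * m 1)) ![ex] from rfl, contract_ex_ω]
    exact contract_scaledField_zero _ _ dy
  rw [d_D₂_f, contract_eq, d_scaledForm_dy (a := fun m => 4 * m 1) (b := fun m => 4 * m 0),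
    smul_scaledForm]
  intro m
  refine (((hasFDerivAt_coord 0 m).const_mul 2).neg.mul
    ((hasFDerivAt_coord 1 m).const_mul 2).neg).congr_fderiv ?_
  ext v
  simp only [Pi.neg_apply, neg_smul, smul_neg, neg_neg, add_apply, smul_apply, PiLp.proj_apply,
    smul_eq_mul]
  ring

theorem contract_X_two : Form.contract (X 2) ω.toForm = 0 := by
  refine (contract_ex_ω _).trans ?_
  simp only [neg_zero, scaledForm_zero]

theorem d_D₂_f_two (i : Fin 3) : (D₂ ω (f i) (f 2)).d = 0 := by
  rw [d_D₂_f, contract_X_two, Form.contract_zero, Form.d_zero, smul_zero]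

theorem lieDeriv_f_two :
    Form.lieDeriv (scaledField (fun m => -(2 * (4 * m 1))) ![]) (f 2)
      = scaledForm (fun _ => -8) dy := by
  have d_f_two : (f 2).d = 0 := by
    rw [← neg_neg (f 2).d, ← (hamiltonianPair_f 2).contract_fst, contract_X_two, neg_zero]
  have contract_eq : Form.contract (scaledField (fun m => -(2 * (4 * m 1))) ![]) (f 2)
      = scaledForm (fun m => -(2 * (4 * m 1)) * 1) one := contract_scaledField_zero _ _ one
  rw [Form.lieDeriv, d_f_two, Form.contract_zero, sub_zero, contract_eq]
  refine d_scaledForm_one fun m =>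
    ((((hasFDerivAt_coord 1 m).const_mul 4).const_mul 2).neg.mul_const 1).congr_fderiv ?_
  ext v
  simp only [one_smul, smul_neg, neg_smul, neg_apply, smul_apply, PiLp.proj_apply, smul_eq_mul]
  ring

theorem jacobiator_f : jacobiator ω deg f = scaledForm (fun _ => -4) dy := by
  have isSemiHamiltonianField_D₂ (i j : Fin 3) := (isHamiltonian_D₂ isNPlectic_ω.smooth
    isNPlectic_ω.closed (isHamiltonian_f i) (isHamiltonian_f j)
    ((isHomogeneous_f i).flip_symDeg 1)
    ((isHomogeneous_f j).flip_symDeg 1)).isSemiHamiltonianField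
  have lieDeriv_zero_one : Form.lieDeriv (semiHamiltonianField ω (D₂ ω (f 0) (f 1))) (f 2)
      = scaledForm (fun _ => -8) dy := by
    rw [← lieDeriv_f_two]
    refine (isHamiltonian_f 2).lieDeriv_eq ?_
    rw [(isSemiHamiltonianField_D₂ 0 1).2, d_D₂_f_zero_one, contract_function_ω, neg_scaledForm]
  have lieDeriv_two (i k : Fin 3) :
      Form.lieDeriv (semiHamiltonianField ω (D₂ ω (f i) (f 2))) (f k) = 0 := by
    rw [← Form.zero_lieDeriv (f k)]
    refine (isHamiltonian_f k).lieDeriv_eq ?_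
    rw [(isSemiHamiltonianField_D₂ i 2).2, d_D₂_f_two, neg_zero, Form.zero_contract]
  have rotate_one : (Equiv.swap 0 2 * Equiv.swap 0 1 : Equiv.Perm (Fin 3)) 1 = 2 := by decide
  rw [jacobiator_eq isNPlectic_ω.smooth isNPlectic_ω.closed isHamiltonian_f isHomogeneous_f
      isSemiHamiltonianField_D₂, sum_shuffles_two_one, Equiv.swap_apply_left, rotate_one]
  simp only [Equiv.Perm.coe_one, id, lieDeriv_zero_one, lieDeriv_two, koszulSign_one, smul_zero,
    add_zero, smul_scaledForm]
  congr 1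
  funext _
  norm_num [symDeg, deg, sgn]

theorem jacobiator_f_ne_zero : jacobiator ω deg f ≠ 0 := by
  intro h
  have value_zero : (-4 : ℝ) * dy ![ey] = 0 :=
    DFunLike.congr_fun (congrFun (congrFun (jacobiator_f.symm.trans h) 1) 0) ![ey]
  norm_num [dy_apply, ey] at value_zero

end PlaneArea

theorem mainTheorem3_general :
    (∃ (d n : ℕ)
        (ω : FormSection (EuclideanSpace ℝ (Fin d)) (EuclideanSpace ℝ (Fin d)) (n + 1))
        (a : Fin 3 → ℕ)
        (f : Fin 3 → Form (EuclideanSpace ℝ (Fin d)) (EuclideanSpace ℝ (Fin d))),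
      IsNPlectic ω ∧ (∀ i, IsHamiltonian ω (f i)) ∧ (∀ i, (f i).IsHomogeneous (a i)) ∧
        jacobiator ω a f ≠ 0) ∧
    (∀ (E : Type*) [NormedAddCommGroup E] [NormedSpace ℝ E] [FiniteDimensional ℝ E]
        (M : Type*) [TopologicalSpace M] [ChartedSpace E M] [IsManifold 𝓘(ℝ, E) (⊤ : ℕ∞) M]
        (n : ℕ) (ω : FormSection E M (n + 1)) (_ : ω.IsSmooth) (_ : FormSection.d ω = 0)
        (a : Fin 3 → ℕ) (f : Fin 3 → Form E M)
        (_ : ∀ i, IsHamiltonian ω (f i)) (_ : ∀ i, (f i).IsHomogeneous (a i)),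
      (∀ i j, ∀ X₁ X₂ : Multivector E M,
        IsSemiHamiltonianField ω (f i) X₁ → IsSemiHamiltonianField ω (f j) X₂ →
        D₂ ω (f i) (f j) =
          sgn (symDeg n (a i)) • Form.lieDeriv X₁ (f j)
            + (sgn₂ (symDeg n (a i)) (symDeg n (a j)) * sgn (symDeg n (a j))) •
              Form.lieDeriv X₂ (f i)) ∧
      (∀ i j, IsHamiltonian ω (D₂ ω (f i) (f j))) ∧
      ∀ XD : Fin 3 → Fin 3 → Multivector E M,
        (∀ i j, IsSemiHamiltonianField ω (D₂ ω (f i) (f j)) (XD i j)) →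
        jacobiator ω a f =
          -(1 / 2 : ℝ) • ∑ s ∈ shuffles 2 1,
            (koszulSign s (fun i => symDeg n (a i)) *
                sgn (symDeg n (a (s 0))) * sgn (symDeg n (a (s 1)))) •
              Form.lieDeriv (XD (s 0) (s 1)) (f (s 2))) := by
  refine ⟨⟨2, 1, PlaneArea.ω, PlaneArea.deg, PlaneArea.f, PlaneArea.isNPlectic_ω,
    PlaneArea.isHamiltonian_f, PlaneArea.isHomogeneous_f, PlaneArea.jacobiator_f_ne_zero⟩, ?_⟩
  intro E _ _ _ M _ _ _ n ω hω hd a f hf ha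
  have hr (i : Fin 3) := (ha i).flip_symDeg n
  exact ⟨fun i j _ _ hX hY => D₂_eq (hf i) (hf j) (hr i) (hr j) hX hY,
    fun i j => isHamiltonian_D₂ hω hd (hf i) (hf j) (hr i) (hr j),
    fun _ hXD => jacobiator_eq hω hd hf ha hXD⟩

end NPlectic

end

open NPlectic in
theorem mainTheorem3 :
    -- the graded Jacobi identity fails in general
    (∃ (d n : ℕ)
        (ω : FormSection (EuclideanSpace ℝ (Fin d)) (EuclideanSpace ℝ (Fin d)) (n + 1))
        (a : Fin 3 → ℕ)
        (f : Fin 3 → Form (EuclideanSpace ℝ (Fin d)) (EuclideanSpace ℝ (Fin d))),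
      IsNPlectic ω ∧ (∀ i, IsHamiltonian ω (f i)) ∧ (∀ i, (f i).IsHomogeneous (a i)) ∧
        jacobiator ω a f ≠ 0) ∧
    (∀ (E : Type*) [NormedAddCommGroup E] [NormedSpace ℝ E] [FiniteDimensional ℝ E]
        (M : Type*) [TopologicalSpace M] [ChartedSpace E M]
        [IsManifold 𝓘(ℝ, E) (⊤ : ℕ∞) M] [T2Space M] [SecondCountableTopology M]
        (n : ℕ) (ω : FormSection E M (n + 1)) (_ : IsNPlectic ω)
        (a : Fin 3 → ℕ) (f : Fin 3 → Form E M)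
        (_ : ∀ i, IsHamiltonian ω (f i)) (_ : ∀ i, (f i).IsHomogeneous (a i)),
      -- `D₂` does not depend on the choice of associated semi-Hamiltonian multivector fields
      (∀ i j, ∀ X₁ X₂ : Multivector E M,
        IsSemiHamiltonianField ω (f i) X₁ → IsSemiHamiltonianField ω (f j) X₂ →
        D₂ ω (f i) (f j) =
          sgn (symDeg n (a i)) • Form.lieDeriv X₁ (f j)
            + (sgn₂ (symDeg n (a i)) (symDeg n (a j)) * sgn (symDeg n (a j))) •
              Form.lieDeriv X₂ (f i)) ∧
      -- `D₂` takes values in Hamiltonian forms, so the fields `X_{D₂}(f i, f j)` exist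
      (∀ i j, IsHamiltonian ω (D₂ ω (f i) (f j))) ∧
      -- the formula for the graded Jacobi expression, for all such fields
      ∀ XD : Fin 3 → Fin 3 → Multivector E M,
        (∀ i j, IsSemiHamiltonianField ω (D₂ ω (f i) (f j)) (XD i j)) →
        jacobiator ω a f =
          -(1 / 2 : ℝ) • ∑ s ∈ shuffles 2 1,
            (koszulSign s (fun i => symDeg n (a i)) *
                sgn (symDeg n (a (s 0))) * sgn (symDeg n (a (s 1)))) •
              Form.lieDeriv (XD (s 0) (s 1)) (f (s 2))) :=
  mainTheorem3_general.imp_right fun general E _ _ _ M _ _ _ _ _ n ω hω =>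
    general E M n ω hω.smooth hω.closed
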